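/- Let $N\ge 1$, $R>0$, let $B_R\subset\mathbb R^N$ be the open ball of radius $R$ centred at the origin, and let $f\colon[0,R]\times\mathbb R\times[0,+\infty[\to\,]{-}\infty,+\infty]$ be a normal integrand, i.e. $f(r,\cdot,\cdot)$ is lower semicontinuous for a.e. $r\in[0,R]$, and there is a Borel function $\hat f\colon[0,R]\times\mathbb R\times[0,+\infty[\to\,]{-}\infty,+\infty]$ with $\hat f(r,\cdot,\cdot)=f(r,\cdot,\cdot)$ for a.e. $r\in[0,R]$. Assume that for almost every $(r,t)\in[0,R]\times\mathbb R$ the map $s\mapsto f(r,t,s)$ is monotone non-decreasing on $[0,+\infty[$. Set $$F(u)=\int_{B_R} f(|x|,u(x),|\nabla u(x)|)\,dx\quad(u\in W^{1,1}_0(B_R)),\qquad F_{\mathrm{rad}}(u)=\int_0^R r^{N-1}f(r,u(r),|u'(r)|)\,dr\quad(u\in W_{\mathrm{rad}}),$$ $$W_{\mathrm{rad}}=\Big\{u\in AC_{\mathrm{loc}}(]0,R]) : u(R)=0,\ r^{N-1}|u'(r)|\in L^1(]0,R[)\Big\}.$$ Here the integral of an extended real-valued function $g$ is $\int g^+-\int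 g^-\in[-\infty,+\infty]$, taken to be $+\infty$ whenever $\int g^+=+\infty$. A solution of a problem $\min\{J(u):u\in W\}$ is an element $u\in W$ with $-\infty<J(u)\le J(v)$ for all $v\in W$. Then the problem $\min\{F(u):u\in W^{1,1}_0(B_R)\}$ admits a solution if and only if the one-dimensional problem $\min\{F_{\mathrm{rad}}(u):u\in W_{\mathrm{rad}}\}$ admits a solution. -/

import Mathlib

open MeasureTheory Set Filter Topology
open scoped ContDiff

noncomputable section

namespace RadialVar

/-- Test functions on an open set `Ω` of `ℝ^N`: smooth real functions whose support is a compact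
subset of `Ω`. -/
def IsTestFunction {N : ℕ} (Ω : Set (EuclideanSpace ℝ (Fin N)))
    (φ : EuclideanSpace ℝ (Fin N) → ℝ) : Prop :=
  ContDiff ℝ ∞ φ ∧ HasCompactSupport φ ∧ tsupport φ ⊆ Ω

/-- `G` is the weak (distributional) gradient of `u` on `Ω`:
`∫_Ω u ∇φ = - ∫_Ω φ G` for all test functions `φ`. -/
def HasWeakGradient {N : ℕ} (Ω : Set (EuclideanSpace ℝ (Fin N)))
    (u : EuclideanSpace ℝ (Fin N) → ℝ)
    (G : EuclideanSpace ℝ (Fin N) → EuclideanSpace ℝ (Fin N)) : Prop :=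
  LocallyIntegrableOn u Ω ∧ LocallyIntegrableOn G Ω ∧
    ∀ φ : EuclideanSpace ℝ (Fin N) → ℝ, IsTestFunction Ω φ →
      ∫ x in Ω, u x • gradient φ x = - ∫ x in Ω, φ x • G x

open Classical in
/-- A version of the weak gradient of `u` on `Ω` (it is unique up to null sets); the value is `0`
if `u` has no weak gradient. -/
def weakGradient {N : ℕ} (Ω : Set (EuclideanSpace ℝ (Fin N)))
    (u : EuclideanSpace ℝ (Fin N) → ℝ) :
    EuclideanSpace ℝ (Fin N) → EuclideanSpace ℝ (Fin N) :=
  if h : ∃ G, HasWeakGradient Ω u G then h.choose else 0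

/-- `u` (a representative) belongs to the Sobolev space `W^{1,1}(Ω)`. -/
def MemW11 {N : ℕ} (Ω : Set (EuclideanSpace ℝ (Fin N)))
    (u : EuclideanSpace ℝ (Fin N) → ℝ) : Prop :=
  IntegrableOn u Ω ∧ (∃ G, HasWeakGradient Ω u G) ∧ IntegrableOn (weakGradient Ω u) Ω

/-- `u` belongs to `W^{1,1}_0(Ω)`, the closure of the test functions in `W^{1,1}(Ω)`. -/
def MemW11Zero {N : ℕ} (Ω : Set (EuclideanSpace ℝ (Fin N)))
    (u : EuclideanSpace ℝ (Fin N) → ℝ) : Prop :=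
  MemW11 Ω u ∧ ∃ φ : ℕ → EuclideanSpace ℝ (Fin N) → ℝ,
    (∀ n, IsTestFunction Ω (φ n)) ∧
    Tendsto (fun n => ∫⁻ x in Ω, ‖u x - φ n x‖ₑ) atTop (𝓝 0) ∧
    Tendsto (fun n => ∫⁻ x in Ω, ‖weakGradient Ω u x - gradient (φ n) x‖ₑ) atTop (𝓝 0)

open Classical in
/-- The extended integral `∫ g⁺ - ∫ g⁻` of an extended real-valued function, equal to `+∞` whenever
`∫ g⁺ = +∞` (in particular in the indeterminate case). -/
def extIntegral {α : Type*} [MeasurableSpace α] (μ : Measure α) (g : α → EReal) : EReal :=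
  if ∫⁻ x, (g x).toENNReal ∂μ = ⊤ then ⊤
  else ((∫⁻ x, (g x).toENNReal ∂μ : ENNReal) : EReal)
    - ((∫⁻ x, (-(g x)).toENNReal ∂μ : ENNReal) : EReal)

/-- `f : [0,R] × ℝ × [0,+∞[ → ]-∞,+∞]` is a normal integrand. The function is given as a total
function, of which only the values on `[0,R] × ℝ × [0,+∞[` matter. -/
structure IsNormalIntegrand (R : ℝ) (f : ℝ → ℝ → ℝ → EReal) : Prop where
  ne_bot : ∀ r ∈ Icc 0 R, ∀ t, ∀ s ∈ Ici (0 : ℝ), f r t s ≠ ⊥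
  lsc : ∀ᵐ r ∂(volume.restrict (Icc 0 R)),
    LowerSemicontinuousOn (fun p : ℝ × ℝ => f r p.1 p.2) (univ ×ˢ Ici 0)
  borel : ∃ g : ℝ × ℝ × ℝ → EReal, Measurable g ∧
    (∀ r ∈ Icc 0 R, ∀ t, ∀ s ∈ Ici (0 : ℝ), g (r, t, s) ≠ ⊥) ∧
    ∀ᵐ r ∂(volume.restrict (Icc 0 R)), ∀ t, ∀ s ∈ Ici (0 : ℝ), g (r, t, s) = f r t s

/-- The functional `F(u) = ∫_{B_R} f(|x|, u, |∇u|) dx`. -/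
def energy (N : ℕ) (R : ℝ) (f : ℝ → ℝ → ℝ → EReal)
    (u : EuclideanSpace ℝ (Fin N) → ℝ) : EReal :=
  extIntegral (volume.restrict (Metric.ball (0 : EuclideanSpace ℝ (Fin N)) R))
    (fun x => f ‖x‖ (u x) ‖weakGradient (Metric.ball 0 R) u x‖)

/-- The space of all `u ∈ AC_loc(]0,R])` with `u(R) = 0` and `r^{N-1} |u'(r)| ∈ L^1(]0,R[)`. -/
def MemWrad (N : ℕ) (R : ℝ) (u : ℝ → ℝ) : Prop :=
  (∀ a ∈ Ioc 0 R, AbsolutelyContinuousOnInterval u a R) ∧ u R = 0 ∧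
    IntegrableOn (fun r => r ^ (N - 1) * |deriv u r|) (Ioo 0 R)

/-- The one-dimensional functional `∫_0^R r^{N-1} f(r, u(r), |u'(r)|) dr`. -/
def radialEnergy (N : ℕ) (R : ℝ) (f : ℝ → ℝ → ℝ → EReal) (u : ℝ → ℝ) : EReal :=
  extIntegral (volume.restrict (Ioo 0 R))
    (fun r => ((r ^ (N - 1) : ℝ) : EReal) * f r (u r) |deriv u r|)

/-- `u` is a solution of the problem `min {J v : v ∈ W}`: it is admissible, `J u` is the least
value of `J` on `W`, and this value is not `-∞`. -/
def IsSolution {X : Type*} (W : X → Prop) (J : X → EReal) (u : X) : Prop :=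
  W u ∧ J u ≠ ⊥ ∧ ∀ v, W v → J u ≤ J v

end RadialVar

end

/-!
Both problems have the same infimum up to the area `c` of the unit sphere, and minimizers can be
transported in both directions.

A function `v ∈ W_rad` gives the radial function `x ↦ v(|x|)`, which lies in `W^{1,1}_0(B_R)`
(`MemWrad.memW11Zero`) and has energy `c · F_rad(v)` by integration in polar coordinates
(`MemWrad.energy_eq`). To approximate it by test functions, the derivative `v'` is approximated in
`L¹(r^{N-1} dr)` by smooth functions with compact support in `]0,R[`, whose primitives are composed
with the norm.

Conversely, let `u ∈ W^{1,1}_0(B_R)`. On almost every ray `r ↦ u(rθ)` coincides with some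
`v_θ ∈ W_rad`, and `v_θ'(r)` is the radial component of `∇u(rθ)` (`ae_exists_memWrad_ray`). If the
integrand does not increase when `|∇u|` is replaced by `|v_θ'|`, then integration over the sphere
gives `F(u) ≥ ∫ F_rad(v_θ) dθ`, so that some `v_θ` satisfies `c · F_rad(v_θ) ≤ F(u)` if
`F(u) > -∞` (`MemW11Zero.exists_memWrad_le`, `exists_slice_extIntegral_le`).

The comparison of the integrands is delicate, because monotonicity is known only for almost every
pair `(r,t)`, and `(|x|, u(x))` may lie in the exceptional null set for `x` in a set of positive
measure. There no monotonicity is needed: almost everywhere on this set the gradient of `u` is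
radial (`ae_inner_skewAdjoint_eq_zero_or_notMem`, `ae_integrand_radial_le`). Indeed, for
skew-adjoint `A` the norm is constant along the orbits `t ↦ exp(tA) x`, along almost every orbit `u`
is absolutely continuous, and a function of one variable has zero derivative almost everywhere on
the preimage of a null set (`volume_setOf_hasDerivAt_ne_zero_mem_null`).
-/

namespace RadialVar

open scoped ENNReal NNReal

/-! ### Polar coordinates and extended integrals -/

/-- The weighted measure `r^{N-1} dr` on the interval `]0,R[`. -/
noncomputable def radialMeasure (N : ℕ) (R : ℝ) : Measure ℝ :=
  (volume.restrict (Ioo 0 R)).withDensity fun r => ENNReal.ofReal (r ^ (N - 1))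

lemma lintegral_radialMeasure (N : ℕ) (R : ℝ) (g : ℝ → ℝ≥0∞) :
    ∫⁻ r, g r ∂(radialMeasure N R) = ∫⁻ r in Ioo 0 R, ENNReal.ofReal (r ^ (N - 1)) * g r := by
  rw [radialMeasure, lintegral_withDensity_eq_lintegral_mul_non_measurable _ (by fun_prop)
    (by simp)]
  rfl

lemma radialMeasure_absolutelyContinuous (N : ℕ) (R : ℝ) :
    radialMeasure N R ≪ volume.restrict (Ioo 0 R) :=
  withDensity_absolutelyContinuous _ _

instance (N : ℕ) (R : ℝ) : IsFiniteMeasure (radialMeasure N R) := by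
  refine isFiniteMeasure_withDensity_ofReal (HasFiniteIntegral.mono' (g := fun _ => |R| ^ (N - 1))
    (integrable_const _).2 ?_)
  filter_upwards [ae_restrict_mem measurableSet_Ioo] with r hr
  rw [norm_pow]
  exact pow_le_pow_left₀ (norm_nonneg _) (abs_le_abs_of_nonneg hr.1.le hr.2.le) _

lemma map_volumeIoiPow (n : ℕ) : (Measure.volumeIoiPow n).map ((↑) : Ioi (0 : ℝ) → ℝ) =
    (volume.restrict (Ioi 0)).withDensity fun r => ENNReal.ofReal (r ^ n) := by
  ext s hs
  rw [Measure.map_apply measurable_subtype_coe hs, Measure.volumeIoiPow,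
    withDensity_apply _ (measurable_subtype_coe hs), withDensity_apply _ hs,
    Measure.restrict_restrict hs,
    setLIntegral_subtype measurableSet_Ioi _ fun a : ℝ ↦ ENNReal.ofReal (a ^ n),
    Subtype.image_preimage_coe, inter_comm]

variable {N : ℕ}

/-- Integration in polar coordinates on a ball centred at the origin. -/
lemma measurePreserving_polar (hN : 1 ≤ N) (R : ℝ) :
    MeasurePreserving (fun p : Metric.sphere (0 : EuclideanSpace ℝ (Fin N)) 1 × ℝ => p.2 • p.1.1)
      ((volume : Measure (EuclideanSpace ℝ (Fin N))).toSphere.prod (radialMeasure N R))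
      (volume.restrict (Metric.ball 0 R)) := by
  have hmeas : Measurable
      (fun p : Metric.sphere (0 : EuclideanSpace ℝ (Fin N)) 1 × ℝ => p.2 • p.1.1) := by fun_prop
  have : Nonempty (Fin N) := ⟨⟨0, hN⟩⟩
  refine ⟨hmeas, ?_⟩
  set σ := (volume : Measure (EuclideanSpace ℝ (Fin N))).toSphere
  have h1 :=
    (volume : Measure (EuclideanSpace ℝ (Fin N))).measurePreserving_homeomorphUnitSphereProd
  have h2 := h1.symm (homeomorphUnitSphereProd (EuclideanSpace ℝ (Fin N))).toMeasurableEquiv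
  -- the polar map is the composition of the inverse homeomorphism with two inclusions
  have h3 : (σ.prod ((Measure.volumeIoiPow (N - 1)).map ((↑) : Ioi (0 : ℝ) → ℝ))).map
      (fun p : Metric.sphere (0 : EuclideanSpace ℝ (Fin N)) 1 × ℝ => p.2 • p.1.1) = volume := by
    have hfin : Module.finrank ℝ (EuclideanSpace ℝ (Fin N)) = N := by simp
    rw [hfin] at h2
    have h4 : σ.prod ((Measure.volumeIoiPow (N - 1)).map ((↑) : Ioi (0 : ℝ) → ℝ)) =
        (σ.prod (Measure.volumeIoiPow (N - 1))).map (Prod.map id ((↑) : Ioi (0 : ℝ) → ℝ)) := by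
      rw [← Measure.map_prod_map _ _ measurable_id measurable_subtype_coe, Measure.map_id]
    rw [h4, Measure.map_map hmeas (by fun_prop)]
    have h5 := congrArg
      (Measure.map (Subtype.val : ({0}ᶜ : Set (EuclideanSpace ℝ (Fin N))) → _)) h2.map_eq
    rw [Measure.map_map measurable_subtype_coe (MeasurableEquiv.measurable _),
      map_comap_subtype_coe (measurableSet_singleton _).compl, restrict_compl_singleton] at h5
    convert! h5 using 2
  have h6 : radialMeasure N R =
      ((Measure.volumeIoiPow (N - 1)).map ((↑) : Ioi (0 : ℝ) → ℝ)).restrict (Iio R) := by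
    rw [map_volumeIoiPow, restrict_withDensity measurableSet_Iio,
      Measure.restrict_restrict measurableSet_Iio, radialMeasure, inter_comm, Ioi_inter_Iio]
  have hpre : ∀ᵐ p ∂(σ.prod ((Measure.volumeIoiPow (N - 1)).map ((↑) : Ioi (0 : ℝ) → ℝ))),
      p ∈ (fun p : Metric.sphere (0 : EuclideanSpace ℝ (Fin N)) 1 × ℝ => p.2 • p.1.1) ⁻¹'
        Metric.ball 0 R ↔ p ∈ (univ : Set _) ×ˢ Iio R := by
    have : ∀ᵐ r ∂((Measure.volumeIoiPow (N - 1)).map ((↑) : Ioi (0 : ℝ) → ℝ)), 0 < r := by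
      rw [map_volumeIoiPow]
      exact (withDensity_absolutelyContinuous _ _).ae_le (ae_restrict_mem measurableSet_Ioi)
    filter_upwards [Measure.quasiMeasurePreserving_snd.ae this] with p hp
    simp [norm_smul, abs_of_pos hp]
  rw [h6, ← Measure.restrict_univ (μ := σ), Measure.prod_restrict,
    ← Measure.restrict_congr_set (eventuallyEq_set.2 hpre),
    ← Measure.restrict_map hmeas Metric.isOpen_ball.measurableSet, h3]

/-- The surface measure of the unit sphere. -/
noncomputable def sphereArea (N : ℕ) : ℝ≥0∞ :=
  (volume : Measure (EuclideanSpace ℝ (Fin N))).toSphere univ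

lemma sphereArea_ne_top : sphereArea N ≠ ⊤ := measure_ne_top _ _

lemma sphereArea_ne_zero (hN : 1 ≤ N) : sphereArea N ≠ 0 := by
  have : Nonempty (Fin N) := ⟨⟨0, hN⟩⟩
  simp only [sphereArea, ne_eq, Measure.measure_univ_eq_zero]
  exact Measure.toSphere_ne_zero _

/-- The image of the Lebesgue measure on a ball under the norm. -/
lemma map_norm_ball (hN : 1 ≤ N) (R : ℝ) :
    (volume.restrict (Metric.ball (0 : EuclideanSpace ℝ (Fin N)) R)).map norm =
      sphereArea N • radialMeasure N R := by
  rw [← (measurePreserving_polar hN R).map_eq, Measure.map_map measurable_norm (by fun_prop)]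
  have : ∀ᵐ p ∂((volume : Measure (EuclideanSpace ℝ (Fin N))).toSphere.prod (radialMeasure N R)),
      (norm ∘ fun p : Metric.sphere (0 : EuclideanSpace ℝ (Fin N)) 1 × ℝ => p.2 • p.1.1) p
        = p.2 := by
    have : ∀ᵐ r ∂(radialMeasure N R), 0 < r :=
      (radialMeasure_absolutelyContinuous N R).ae_le <| by
        filter_upwards [ae_restrict_mem measurableSet_Ioo] with r hr using hr.1
    filter_upwards [Measure.quasiMeasurePreserving_snd.ae this] with p hp
    simp [norm_smul, abs_of_pos hp]
  rw [Measure.map_congr this, sphereArea]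
  exact Measure.map_snd_prod

lemma ae_ball_of_ae_Ioo (hN : 1 ≤ N) {R : ℝ} {p : ℝ → Prop}
    (h : ∀ᵐ r ∂(volume.restrict (Ioo 0 R)), p r) :
    ∀ᵐ x ∂(volume.restrict (Metric.ball (0 : EuclideanSpace ℝ (Fin N)) R)), p ‖x‖ := by
  refine ae_of_ae_map measurable_norm.aemeasurable ?_
  rw [map_norm_ball hN]
  exact Measure.ae_smul_measure ((radialMeasure_absolutelyContinuous N R).ae_le h) _

lemma ae_ae_polar (hN : 1 ≤ N) {R : ℝ} {p : EuclideanSpace ℝ (Fin N) → Prop}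
    (h : ∀ᵐ x ∂(volume.restrict (Metric.ball 0 R)), p x) :
    ∀ᵐ θ ∂(volume : Measure (EuclideanSpace ℝ (Fin N))).toSphere,
      ∀ᵐ r ∂(radialMeasure N R), p (r • θ.1) :=
  Measure.ae_ae_of_ae_prod ((measurePreserving_polar hN R).quasiMeasurePreserving.ae h)

lemma lintegral_ball_norm (hN : 1 ≤ N) (R : ℝ) {g : ℝ → ℝ≥0∞}
    (hg : AEMeasurable g (volume.restrict (Ioo 0 R))) :
    ∫⁻ x in Metric.ball (0 : EuclideanSpace ℝ (Fin N)) R, g ‖x‖ =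
      sphereArea N * ∫⁻ r, g r ∂(radialMeasure N R) := by
  rw [← lintegral_map' (f := g) ?_ measurable_norm.aemeasurable, map_norm_ball hN,
    lintegral_smul_measure, smul_eq_mul]
  rw [map_norm_ball hN]
  exact (hg.mono_ac (radialMeasure_absolutelyContinuous N R)).smul_measure _

lemma extIntegral_mono {α : Type*} [MeasurableSpace α] {μ : Measure α} {g h : α → EReal}
    (hgh : ∀ᵐ x ∂μ, g x ≤ h x) : extIntegral μ g ≤ extIntegral μ h := by
  have h1 : ∫⁻ x, (g x).toENNReal ∂μ ≤ ∫⁻ x, (h x).toENNReal ∂μ :=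
    lintegral_mono_ae (by filter_upwards [hgh] with x hx using EReal.toENNReal_le_toENNReal hx)
  have h2 : ∫⁻ x, (-(h x)).toENNReal ∂μ ≤ ∫⁻ x, (-(g x)).toENNReal ∂μ :=
    lintegral_mono_ae (by
      filter_upwards [hgh] with x hx using
        EReal.toENNReal_le_toENNReal (EReal.neg_le_neg_iff.2 hx))
  unfold extIntegral
  split_ifs with h3 h4
  · exact le_rfl
  · exact absurd (top_unique (h3 ▸ h1)) h4
  · exact le_top
  · exact EReal.sub_le_sub (by exact_mod_cast h1) (by exact_mod_cast h2)

lemma extIntegral_congr {α : Type*} [MeasurableSpace α] {μ : Measure α} {g h : α → EReal}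
    (hgh : ∀ᵐ x ∂μ, g x = h x) : extIntegral μ g = extIntegral μ h :=
  le_antisymm (extIntegral_mono (hgh.mono fun _ h => h.le))
    (extIntegral_mono (hgh.mono fun _ h => h.ge))

lemma extIntegral_map {α β : Type*} [MeasurableSpace α] [MeasurableSpace β] {μ : Measure α}
    {φ : α → β} (hφ : AEMeasurable φ μ) {g : β → EReal} (hg : AEMeasurable g (μ.map φ)) :
    extIntegral (μ.map φ) g = extIntegral μ (fun x => g (φ x)) := by
  unfold extIntegral
  rw [lintegral_map' (by fun_prop) hφ, lintegral_map' (by fun_prop) hφ]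

lemma extIntegral_smul_measure {α : Type*} [MeasurableSpace α] {μ : Measure α} {g : α → EReal}
    {c : ℝ≥0∞} (hc : c ≠ 0) (hc' : c ≠ ⊤) :
    extIntegral (c • μ) g = (c : EReal) * extIntegral μ g := by
  unfold extIntegral
  simp only [lintegral_smul_measure, smul_eq_mul, ENNReal.mul_eq_top, hc, hc', ne_eq,
    not_false_eq_true, true_and, false_and, or_false]
  lift c to NNReal using hc'
  have hc0 : (0 : ℝ) < c := by
    have : 0 < c := pos_iff_ne_zero.2 (by simpa using hc)
    exact_mod_cast this
  have hcE : ((c : ℝ≥0∞) : EReal) = ((c : ℝ) : EReal) := rfl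
  split_ifs with h
  · rw [hcE, EReal.coe_mul_top_of_pos hc0]
  · lift (∫⁻ x, (g x).toENNReal ∂μ) to NNReal using h with p
    rcases eq_or_ne (∫⁻ x, (-(g x)).toENNReal ∂μ) ⊤ with h' | h'
    · rw [h', ENNReal.mul_top hc, hcE]
      simp [EReal.coe_mul_bot_of_pos hc0, ← ENNReal.coe_mul, sub_eq_add_neg]
    · lift (∫⁻ x, (-(g x)).toENNReal ∂μ) to NNReal using h' with q
      rw [← ENNReal.coe_mul, ← ENNReal.coe_mul]
      change (((c * p : NNReal) : ℝ) : EReal) - (((c * q : NNReal) : ℝ) : EReal)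
        = ((c : ℝ) : EReal) * (((p : ℝ) : EReal) - ((q : ℝ) : EReal))
      rw [← EReal.coe_sub, ← EReal.coe_sub, ← EReal.coe_mul]
      congr 1
      push_cast
      ring

lemma radialEnergy_eq (N : ℕ) (R : ℝ) (f : ℝ → ℝ → ℝ → EReal) (u : ℝ → ℝ) :
    radialEnergy N R f u = extIntegral (radialMeasure N R) (fun r => f r (u r) |deriv u r|) := by
  have key : ∀ r ∈ Ioo 0 R, ∀ y : EReal, (((r ^ (N - 1) : ℝ) : EReal) * y).toENNReal =
      ENNReal.ofReal (r ^ (N - 1)) * y.toENNReal := by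
    intro r hr y
    rw [EReal.toENNReal_mul (by exact_mod_cast (pow_pos hr.1 _).le),
      EReal.toENNReal_of_ne_top (EReal.coe_ne_top _), EReal.toReal_coe]
  unfold radialEnergy extIntegral
  have h1 := setLIntegral_congr_fun (μ := volume) (measurableSet_Ioo (a := 0) (b := R))
    fun r hr => key r hr (f r (u r) |deriv u r|)
  have h2 := setLIntegral_congr_fun (μ := volume) (measurableSet_Ioo (a := 0) (b := R))
    fun r hr => key r hr (-f r (u r) |deriv u r|)
  simp only [lintegral_radialMeasure, ← mul_neg, h1, h2]

/-- If the extended integral over a product is at most `M > -∞`, then on some slice the extended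
integral is at most the mean value `M / σ(univ)`. The bound `M ≠ ⊥` is needed, since the negative
parts of the slices may all be finite without having a finite integral. -/
lemma exists_slice_extIntegral_le {α β : Type*} [MeasurableSpace α] [MeasurableSpace β]
    {σ : Measure α} {m : Measure β} [IsFiniteMeasure σ] [SFinite m] (hσ : σ ≠ 0)
    {K : α × β → EReal} (hK : AEMeasurable K (σ.prod m)) {p : α → Prop} (hp : ∀ᵐ θ ∂σ, p θ)
    {M : EReal} (hM : M ≠ ⊥) (hKM : extIntegral (σ.prod m) K ≤ M) :
    ∃ θ, p θ ∧ (σ univ : EReal) * extIntegral m (fun r => K (θ, r)) ≤ M := by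
  have : NeBot (ae σ) := ae_neBot.2 hσ
  by_contra! hcon
  have hall : ∀ᵐ θ ∂σ, M < (σ univ : EReal) * extIntegral m (fun r => K (θ, r)) :=
    hp.mono fun θ hθ => hcon θ hθ
  have hMtop : M ≠ ⊤ := by
    rintro rfl
    obtain ⟨θ, hθ⟩ := hall.exists
    exact not_top_lt hθ
  lift M to ℝ using ⟨hMtop, hM⟩
  have hprod : ∀ F : EReal → EReal, Measurable F →
      ∫⁻ z, (F (K z)).toENNReal ∂(σ.prod m) = ∫⁻ θ, ∫⁻ r, (F (K (θ, r))).toENNReal ∂m ∂σ :=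
    fun F hF => lintegral_prod _ ((hF.comp_aemeasurable hK).ereal_toENNReal)
  set P : α → ℝ≥0∞ := fun θ => ∫⁻ r, (K (θ, r)).toENNReal ∂m with hP
  set Q : α → ℝ≥0∞ := fun θ => ∫⁻ r, (-(K (θ, r))).toENNReal ∂m with hQ
  have hPm : AEMeasurable P σ := hK.ereal_toENNReal.lintegral_prod_right'
  have hQm : AEMeasurable Q σ :=
    ((measurable_neg.comp_aemeasurable hK).ereal_toENNReal).lintegral_prod_right'
  have hPt : ∫⁻ z, (K z).toENNReal ∂(σ.prod m) = ∫⁻ θ, P θ ∂σ := hprod id measurable_id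
  have hQt : ∫⁻ z, (-(K z)).toENNReal ∂(σ.prod m) = ∫⁻ θ, Q θ ∂σ := hprod _ measurable_neg
  unfold extIntegral at hKM
  rw [hPt, hQt] at hKM
  split_ifs at hKM with h0
  · exact absurd hKM (by simp)
  have hPfin : ∀ᵐ θ ∂σ, P θ < ⊤ := ae_lt_top' hPm h0
  have hσ0 : σ univ ≠ 0 := by simpa using hσ
  have hσt : σ univ ≠ ⊤ := measure_ne_top _ _
  -- `A - B = M / σ univ`, split into positive and negative part to stay in `ℝ≥0∞`
  set A : ℝ≥0∞ := ENNReal.ofReal M / σ univ with hA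
  set B : ℝ≥0∞ := ENNReal.ofReal (-M) / σ univ with hB
  have hAt : A ≠ ⊤ := ENNReal.div_ne_top ENNReal.ofReal_ne_top hσ0
  have hBt : B ≠ ⊤ := ENNReal.div_ne_top ENNReal.ofReal_ne_top hσ0
  have hslice : ∀ᵐ θ ∂σ, Q θ + A < P θ + B := by
    filter_upwards [hall, hPfin] with θ h1 h2
    unfold extIntegral at h1
    rw [if_neg h2.ne] at h1
    change (M : EReal) < (σ univ : EReal) * ((P θ : EReal) - (Q θ : EReal)) at h1
    generalize P θ = p at *
    generalize Q θ = q at *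
    generalize σ univ = s at *
    lift p to NNReal using h2.ne
    lift s to NNReal using hσt
    have hs : (0 : ℝ) < s := by
      have : 0 < s := pos_iff_ne_zero.2 (by simpa using hσ0)
      exact_mod_cast this
    have hsE : ((s : ℝ≥0∞) : EReal) = ((s : ℝ) : EReal) := rfl
    have hq : q ≠ ⊤ := by
      rintro rfl
      rw [hsE] at h1
      simp [EReal.coe_mul_bot_of_pos hs, sub_eq_add_neg] at h1
    lift q to NNReal using hq
    change (M : EReal) < ((s : ℝ) : EReal) * (((p : ℝ) : EReal) - ((q : ℝ) : EReal)) at h1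
    norm_cast at h1
    rw [← ENNReal.toReal_lt_toReal (by simp [hAt]) (by simp [hBt]),
      ENNReal.toReal_add (by simp) hAt, ENNReal.toReal_add (by simp) hBt, hA, hB,
      ENNReal.toReal_div, ENNReal.toReal_div, ENNReal.toReal_ofReal', ENNReal.toReal_ofReal']
    simp only [ENNReal.coe_toReal]
    have h3 : max M 0 / (s : ℝ) = M / s + max (-M) 0 / s := by
      rw [← add_div]
      congr 1
      rcases le_total M 0 with h | h
      · rw [max_eq_right h, max_eq_left (by linarith)]; ring
      · rw [max_eq_left h, max_eq_right (by linarith)]; ring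
    have h4 : M / s < p - q := by rw [div_lt_iff₀ hs]; linarith
    linarith
  have hint : ∫⁻ θ, (Q θ + A) ∂σ < ∫⁻ θ, (P θ + B) ∂σ := by
    have hfin : ∫⁻ θ, (P θ + B) ∂σ ≠ ⊤ := by
      rw [lintegral_add_left' hPm, lintegral_const]
      exact ENNReal.add_ne_top.2 ⟨h0, ENNReal.mul_ne_top hBt hσt⟩
    refine lintegral_strict_mono hσ (hPm.add_const _) ?_ hslice
    exact ne_top_of_le_ne_top hfin (lintegral_mono_ae (hslice.mono fun _ h => h.le))
  rw [lintegral_add_left' hPm, lintegral_add_left' hQm, lintegral_const, lintegral_const,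
    ENNReal.div_mul_cancel hσ0 hσt, ENNReal.div_mul_cancel hσ0 hσt] at hint
  generalize ∫⁻ θ, P θ ∂σ = p at *
  generalize ∫⁻ θ, Q θ ∂σ = q at *
  have hq : q ≠ ⊤ := by
    rintro rfl
    simp at hint
  lift p to NNReal using h0
  lift q to NNReal using hq
  change ((p : ℝ) : EReal) - ((q : ℝ) : EReal) ≤ (M : EReal) at hKM
  norm_cast at hKM
  rw [← ENNReal.toReal_lt_toReal (by simp) (by simp), ENNReal.toReal_add (by simp) (by simp),
    ENNReal.toReal_add (by simp) (by simp), ENNReal.toReal_ofReal', ENNReal.toReal_ofReal'] at hint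
  simp only [ENNReal.coe_toReal] at hint
  have h3 : max M 0 = M + max (-M) 0 := by
    rcases le_total M 0 with h | h
    · rw [max_eq_right h, max_eq_left (by linarith)]; ring
    · rw [max_eq_left h, max_eq_right (by linarith)]; ring
  linarith

/-! ### Limits of smooth functions in one variable -/

/-- A sequence tending to zero in `L¹` of a product has a subsequence which tends to zero in `L¹`
on almost every slice. -/
lemma exists_subseq_slice_tendsto {α β : Type*} [MeasurableSpace α] [MeasurableSpace β]
    {μ : Measure α} {ν : Measure β} [SFinite ν] {h : ℕ → α × β → ℝ≥0∞}
    (hm : ∀ n, AEMeasurable (h n) (μ.prod ν))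
    (h0 : Tendsto (fun n => ∫⁻ z, h n z ∂(μ.prod ν)) atTop (𝓝 0)) :
    ∃ ns : ℕ → ℕ, StrictMono ns ∧
      ∀ᵐ x ∂μ, Tendsto (fun k => ∫⁻ y, h (ns k) (x, y) ∂ν) atTop (𝓝 0) := by
  have hev : ∀ k : ℕ, ∀ᶠ n in atTop, ∫⁻ z, h n z ∂(μ.prod ν) ≤ (2⁻¹ : ℝ≥0∞) ^ k := fun k =>
    (h0.eventually_lt_const (by simp [ENNReal.pow_pos])).mono fun _ h => h.le
  obtain ⟨ns, hns, hle⟩ := extraction_forall_of_eventually hev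
  refine ⟨ns, hns, ?_⟩
  have hmk : ∀ k, AEMeasurable (fun x => ∫⁻ y, h (ns k) (x, y) ∂ν) μ :=
    fun k => (hm _).lintegral_prod_right'
  have hsum : ∫⁻ x, ∑' k, ∫⁻ y, h (ns k) (x, y) ∂ν ∂μ ≠ ⊤ := by
    rw [lintegral_tsum hmk]
    refine ne_top_of_le_ne_top ?_ (ENNReal.tsum_le_tsum fun k => ?_) (b := ∑' k, 2⁻¹ ^ k)
    · rw [ENNReal.tsum_geometric]
      simp
    · rw [← lintegral_prod _ (hm _)]
      exact hle k
  filter_upwards [ae_lt_top' (AEMeasurable.tsum hmk) hsum] with x hx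
  exact ENNReal.tendsto_atTop_zero_of_tsum_ne_top hx.ne

/-- An `L¹` limit of `C¹` functions whose derivatives converge in `L¹` is the primitive of the
limit of the derivatives. -/
lemma ae_eq_sub_integral_of_tendsto {a b : ℝ} (hab : a < b) {φ φ' : ℕ → ℝ → ℝ} {v g : ℝ → ℝ}
    (hφ : ∀ n t, HasDerivAt (φ n) (φ' n t) t) (hφ' : ∀ n, Continuous (φ' n))
    (hv : AEStronglyMeasurable v (volume.restrict (Ioc a b)))
    (hg : AEStronglyMeasurable g (volume.restrict (Ioc a b)))
    (h1 : Tendsto (fun n => ∫⁻ t in Ioc a b, ‖v t - φ n t‖ₑ) atTop (𝓝 0))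
    (h2 : Tendsto (fun n => ∫⁻ t in Ioc a b, ‖g t - φ' n t‖ₑ) atTop (𝓝 0)) :
    IntervalIntegrable g volume a b ∧
      ∃ C, (∀ᵐ t ∂(volume.restrict (Ioc a b)), v t = C - ∫ s in t..b, g s) ∧
        ((∀ n, φ n b = 0) → C = 0) := by
  have hφ'i : ∀ n, IntegrableOn (φ' n) (Ioc a b) := fun n =>
    ((hφ' n).intervalIntegrable a b).1
  have hgi : IntegrableOn g (Ioc a b) := by
    obtain ⟨n, hn⟩ := (h2.eventually_lt_const ENNReal.zero_lt_top).exists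
    have : IntegrableOn (fun t => g t - φ' n t) (Ioc a b) :=
      ⟨hg.sub (hφ' n).aestronglyMeasurable, hn⟩
    exact (this.add (hφ'i n)).congr (ae_of_all _ fun t => by simp)
  refine ⟨(intervalIntegrable_iff_integrableOn_Ioc_of_le hab.le).2 hgi, ?_⟩
  have hint : ∀ t ∈ Ioc a b, Tendsto (fun n => ∫ s in t..b, φ' n s) atTop
      (𝓝 (∫ s in t..b, g s)) := by
    intro t ht
    have h3 := tendsto_setIntegral_of_L1 (μ := volume.restrict (Ioc a b)) g hgi.aestronglyMeasurable
      (Eventually.of_forall hφ'i) (by simpa only [enorm_sub_rev] using h2) (Ioc t b)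
    have h4 : ∀ w : ℝ → ℝ, ∫ s in t..b, w s = ∫ s in Ioc t b, w s ∂(volume.restrict (Ioc a b)) := by
      intro w
      rw [Measure.restrict_restrict measurableSet_Ioc, intervalIntegral.integral_of_le ht.2,
        inter_eq_left.2 (Ioc_subset_Ioc_left ht.1.le)]
    simpa only [h4] using h3
  have hmeas : TendstoInMeasure (volume.restrict (Ioc a b)) φ atTop v := by
    refine tendstoInMeasure_of_tendsto_eLpNorm one_ne_zero
      (fun n => (continuous_iff_continuousAt.2 fun t => (hφ n t).continuousAt).aestronglyMeasurable)
      hv ?_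
    simpa only [eLpNorm_one_eq_lintegral_enorm, Pi.sub_apply, enorm_sub_rev] using h1
  obtain ⟨ns, hns, hlim⟩ := hmeas.exists_seq_tendsto_ae
  -- the values at the endpoint converge along the subsequence; this gives the constant `C`
  have hend : ∀ᵐ t ∂(volume.restrict (Ioc a b)),
      Tendsto (fun k => φ (ns k) b) atTop (𝓝 (v t + ∫ s in t..b, g s)) := by
    filter_upwards [hlim, ae_restrict_mem measurableSet_Ioc] with t ht htab
    have h5 := ht.add ((hint t htab).comp hns.tendsto_atTop)
    refine h5.congr fun k => ?_
    have h6 : ∫ s in t..b, φ' (ns k) s = φ (ns k) b - φ (ns k) t :=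
      intervalIntegral.integral_eq_sub_of_hasDerivAt (fun s _ => hφ _ s)
        ((hφ' _).intervalIntegrable _ _)
    simp [h6]
  have : NeBot (ae (volume.restrict (Ioc a b))) := ae_neBot.2 (by
    simp [Measure.restrict_eq_zero, hab])
  obtain ⟨t₀, ht₀⟩ := hend.exists
  refine ⟨_, ?_, fun h => tendsto_nhds_unique ht₀ (by simp [h])⟩
  filter_upwards [hend] with t ht
  rw [tendsto_nhds_unique ht₀ ht]
  ring

/-- A function of one variable has zero derivative almost everywhere on the preimage of a null
set, wherever it is differentiable. Where the derivative is nonzero the function expands distances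
locally up to a factor, so that the set in question is a countable union of Lipschitz images of
null sets. -/
lemma volume_setOf_hasDerivAt_ne_zero_mem_null {w : ℝ → ℝ} {Z : Set ℝ} (hZ : volume Z = 0) :
    volume {t | ∃ d ≠ 0, HasDerivAt w d t ∧ w t ∈ Z} = 0 := by
  -- on `A (n, k)` the inverse of `w` is Lipschitz with constant `n + 1`: the points of this set
  -- expand distances at scale `1 / (n + 1)` and lie in an interval of this length
  set A : ℕ × ℤ → Set ℝ := fun p => {t | w t ∈ Z ∧
    (t ∈ Ico ((p.2 : ℝ) * (p.1 + 1 : ℝ)⁻¹) ((p.2 + 1 : ℝ) * (p.1 + 1 : ℝ)⁻¹)) ∧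
    ∀ y, |y - t| < (p.1 + 1 : ℝ)⁻¹ → |y - t| ≤ (p.1 + 1) * |w y - w t|} with hA
  have hcover : {t | ∃ d ≠ 0, HasDerivAt w d t ∧ w t ∈ Z} ⊆ ⋃ p, A p := by
    rintro t ⟨d, hd, hw, ht⟩
    have h1 : ∀ᶠ y in 𝓝 t, |y - t| * (|d| / 2) ≤ |w y - w t| := by
      have h2 := (hasDerivAt_iff_isLittleO.1 hw).bound (half_pos (abs_pos.2 hd))
      filter_upwards [h2] with y hy
      simp only [Real.norm_eq_abs, smul_eq_mul] at hy
      have h3 : |(y - t) * d| ≤ |w y - w t| + |w y - w t - (y - t) * d| := by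
        have := abs_sub (w y - w t) (w y - w t - (y - t) * d)
        simpa using this
      rw [abs_mul] at h3
      nlinarith
    obtain ⟨ε, hε, hball⟩ := Metric.eventually_nhds_iff.1 h1
    obtain ⟨n, hn⟩ := exists_nat_gt (max (2 / |d|) ε⁻¹)
    have hn0 : (0 : ℝ) < n + 1 := by positivity
    have hnε : (n + 1 : ℝ)⁻¹ < ε := by
      rw [inv_lt_comm₀ hn0 hε]
      linarith [le_max_right (2 / |d|) ε⁻¹]
    have hnd : 1 ≤ (n + 1 : ℝ) * (|d| / 2) := by
      have h4 : 2 / |d| < n + 1 := by linarith [le_max_left (2 / |d|) ε⁻¹]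
      rw [div_lt_iff₀ (abs_pos.2 hd)] at h4
      linarith
    refine mem_iUnion.2 ⟨(n, ⌊t * (n + 1)⌋), ht, ⟨?_, ?_⟩, fun y hy => ?_⟩
    · rw [← div_eq_mul_inv, div_le_iff₀ hn0]
      exact Int.floor_le _
    · rw [← div_eq_mul_inv, lt_div_iff₀ hn0]
      exact Int.lt_floor_add_one _
    · have h5 := hball (y := y) (by rw [Real.dist_eq]; exact hy.trans hnε)
      calc |y - t| ≤ |y - t| * ((n + 1 : ℝ) * (|d| / 2)) :=
            le_mul_of_one_le_right (abs_nonneg _) hnd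
        _ = (n + 1) * (|y - t| * (|d| / 2)) := by ring
        _ ≤ (n + 1) * |w y - w t| := by gcongr
  refine measure_mono_null hcover (measure_iUnion_null fun p => ?_)
  have hanti : AntilipschitzWith (p.1 + 1 : ℝ≥0) ((A p).domRestrict w) := by
    refine AntilipschitzWith.of_le_mul_dist fun x y => ?_
    have hx := x.2.2.1
    have hy := y.2.2.1
    have hlt : |x.1 - y.1| < (p.1 + 1 : ℝ)⁻¹ := by
      rw [abs_lt]
      have : ((p.2 : ℝ) + 1) * (p.1 + 1 : ℝ)⁻¹ = (p.2 : ℝ) * (p.1 + 1 : ℝ)⁻¹ + (p.1 + 1 : ℝ)⁻¹ := by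
        ring
      constructor <;> linarith [hx.1, hx.2, hy.1, hy.2]
    have := y.2.2.2 x hlt
    simpa [Subtype.dist_eq, Real.dist_eq, Set.domRestrict] using this
  have h6 := hanti.le_hausdorffMeasure_image zero_le_one univ
  have h7 : (A p).domRestrict w '' univ ⊆ Z := by
    rintro _ ⟨x, -, rfl⟩
    exact x.2.1
  have h8 : Measure.hausdorffMeasure 1 ((A p).domRestrict w '' univ) = 0 := by
    rw [hausdorffMeasure_real]
    exact measure_mono_null h7 hZ
  rw [h8, mul_zero] at h6
  have h9 := (isometry_subtype_coe (s := A p)).hausdorffMeasure_image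
    (Or.inl zero_le_one) univ
  rw [image_univ, Subtype.range_coe, hausdorffMeasure_real] at h9
  rw [h9]
  exact le_antisymm h6 bot_le

/-- In the situation of `ae_eq_sub_integral_of_tendsto`, the derivative of the limit vanishes
almost everywhere where the limit takes its values in a null set. -/
lemma ae_deriv_eq_zero_or_notMem_of_tendsto {a b : ℝ} (hab : a < b) {φ φ' : ℕ → ℝ → ℝ}
    {v g : ℝ → ℝ}
    (hφ : ∀ n t, HasDerivAt (φ n) (φ' n t) t) (hφ' : ∀ n, Continuous (φ' n))
    (hv : AEStronglyMeasurable v (volume.restrict (Ioc a b)))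
    (hg : AEStronglyMeasurable g (volume.restrict (Ioc a b)))
    (h1 : Tendsto (fun n => ∫⁻ t in Ioc a b, ‖v t - φ n t‖ₑ) atTop (𝓝 0))
    (h2 : Tendsto (fun n => ∫⁻ t in Ioc a b, ‖g t - φ' n t‖ₑ) atTop (𝓝 0))
    {Z : Set ℝ} (hZ : volume Z = 0) :
    ∀ᵐ t ∂(volume.restrict (Ioc a b)), g t = 0 ∨ v t ∉ Z := by
  obtain ⟨hgi, C, hC, -⟩ := ae_eq_sub_integral_of_tendsto hab hφ hφ' hv hg h1 h2
  have hnull := volume_setOf_hasDerivAt_ne_zero_mem_null (w := fun t => C + ∫ s in b..t, g s) hZ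
  have hder := hgi.ae_hasDerivAt_integral
  filter_upwards [hC, ae_restrict_mem measurableSet_Ioc, ae_restrict_of_ae hder,
    ae_restrict_of_ae (measure_eq_zero_iff_ae_notMem.1 hnull)] with t hvt ht hd hn
  by_contra! hcon
  refine hn ⟨g t, hcon.1, ?_, ?_⟩
  · have htu : t ∈ uIcc a b := by rw [uIcc_of_le hab.le]; exact Ioc_subset_Icc_self ht
    exact (hd htu b right_mem_uIcc).const_add C
  · rw [intervalIntegral.integral_symm, ← sub_eq_add_neg, ← hvt]
    exact hcon.2

/-! ### Weak gradients of limits of test functions -/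

variable {Ω : Set (EuclideanSpace ℝ (Fin N))}

lemma inner_gradient (φ : EuclideanSpace ℝ (Fin N) → ℝ) (x v : EuclideanSpace ℝ (Fin N)) :
    inner ℝ (gradient φ x) v = fderiv ℝ φ x v := by
  simp [gradient]

lemma continuous_gradient {φ : EuclideanSpace ℝ (Fin N) → ℝ} (hφ : ContDiff ℝ ∞ φ) :
    Continuous (gradient φ) :=
  (InnerProductSpace.toDual ℝ _).symm.continuous.comp (hφ.continuous_fderiv (by simp))

lemma gradient_eq_zero_of_notMem_tsupport {φ : EuclideanSpace ℝ (Fin N) → ℝ}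
    {x : EuclideanSpace ℝ (Fin N)} (hx : x ∉ tsupport φ) : gradient φ x = 0 := by
  have : fderiv ℝ φ x = 0 := by
    by_contra h
    exact hx (support_fderiv_subset ℝ h)
  simp [gradient, this]

lemma hasCompactSupport_gradient {φ : EuclideanSpace ℝ (Fin N) → ℝ} (hφ : HasCompactSupport φ) :
    HasCompactSupport (gradient φ) :=
  HasCompactSupport.intro' hφ (isClosed_tsupport φ) fun _ hx =>
    gradient_eq_zero_of_notMem_tsupport hx

lemma integral_smul_gradient_eq_neg {φ ψ : EuclideanSpace ℝ (Fin N) → ℝ} (hφ : ContDiff ℝ ∞ φ)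
    (hφc : HasCompactSupport φ) (hψ : ContDiff ℝ ∞ ψ) (hψc : HasCompactSupport ψ) :
    ∫ x, φ x • gradient ψ x = - ∫ x, ψ x • gradient φ x := by
  have hi : ∀ {φ ψ : EuclideanSpace ℝ (Fin N) → ℝ}, ContDiff ℝ ∞ φ → HasCompactSupport φ →
      ContDiff ℝ ∞ ψ → Integrable (fun x => φ x • gradient ψ x) := fun h1 h2 h3 =>
    (h1.continuous.smul (continuous_gradient h3)).integrable_of_hasCompactSupport h2.smul_right
  have e : ∀ (φ ψ : EuclideanSpace ℝ (Fin N) → ℝ) (v x : EuclideanSpace ℝ (Fin N)),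
      inner ℝ v (φ x • gradient ψ x) = φ x * fderiv ℝ ψ x v := by
    intro φ ψ v x
    rw [real_inner_smul_right, real_inner_comm, inner_gradient]
  refine ext_inner_left ℝ fun v => ?_
  rw [inner_neg_right, ← integral_inner (hi hφ hφc hψ), ← integral_inner (hi hψ hψc hφ)]
  simp only [e]
  rw [integral_mul_fderiv_eq_neg_fderiv_mul_of_integrable]
  · simp only [mul_comm]
  · simpa only [e, mul_comm] using (hi hψ hψc hφ).const_inner (𝕜 := ℝ) v
  · simpa only [e] using (hi hφ hφc hψ).const_inner (𝕜 := ℝ) v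
  · exact (hφ.continuous.mul hψ.continuous).integrable_of_hasCompactSupport hφc.mul_right
  · exact fun x _ => (hφ.differentiable (by simp)) x
  · exact fun x _ => (hψ.differentiable (by simp)) x

lemma setIntegral_smul_gradient_eq_neg {φ ψ : EuclideanSpace ℝ (Fin N) → ℝ}
    (hφ : IsTestFunction Ω φ) (hψ : IsTestFunction Ω ψ) :
    ∫ x in Ω, φ x • gradient ψ x = - ∫ x in Ω, ψ x • gradient φ x := by
  rw [setIntegral_eq_integral_of_forall_compl_eq_zero,
    setIntegral_eq_integral_of_forall_compl_eq_zero,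
    integral_smul_gradient_eq_neg hφ.1 hφ.2.1 hψ.1 hψ.2.1]
  · intro x hx
    rw [image_eq_zero_of_notMem_tsupport fun h => hx (hψ.2.2 h), zero_smul]
  · intro x hx
    rw [image_eq_zero_of_notMem_tsupport fun h => hx (hφ.2.2 h), zero_smul]

/-- Convergence of integrals under `L¹` convergence, in a form suited to products with a bounded
factor: `e n` is the `L¹` error and `C` bounds the factor. -/
lemma tendsto_integral_of_lintegral_le {α F : Type*} [MeasurableSpace α] [NormedAddCommGroup F]
    [NormedSpace ℝ F] {μ : Measure α} {f : α → F} {fn : ℕ → α → F} {C : ℝ≥0} {e : ℕ → α → ℝ≥0∞}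
    (hf : AEStronglyMeasurable f μ) (hfn : ∀ n, Integrable (fn n) μ)
    (hle : ∀ n x, ‖fn n x - f x‖ₑ ≤ C * e n x)
    (he : Tendsto (fun n => ∫⁻ x, e n x ∂μ) atTop (𝓝 0)) :
    Tendsto (fun n => ∫ x, fn n x ∂μ) atTop (𝓝 (∫ x, f x ∂μ)) := by
  refine tendsto_integral_of_L1 f hf (Eventually.of_forall hfn) ?_
  refine tendsto_of_tendsto_of_tendsto_of_le_of_le tendsto_const_nhds
    (h := fun n => C * ∫⁻ x, e n x ∂μ) ?_ (fun n => bot_le) (fun n => ?_)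
  · simpa using ENNReal.Tendsto.const_mul he (Or.inr (ENNReal.coe_ne_top (r := C)))
  · beta_reduce
    rw [← lintegral_const_mul' _ _ ENNReal.coe_ne_top]
    exact lintegral_mono (hle n)

lemma integrable_of_tendsto_lintegral {α F : Type*} [MeasurableSpace α] [NormedAddCommGroup F]
    {μ : Measure α} {f : α → F} {fn : ℕ → α → F} (hf : AEStronglyMeasurable f μ)
    (hfn : ∀ n, Integrable (fn n) μ)
    (h : Tendsto (fun n => ∫⁻ x, ‖f x - fn n x‖ₑ ∂μ) atTop (𝓝 0)) : Integrable f μ := by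
  obtain ⟨n, hn⟩ := (h.eventually_lt_const ENNReal.zero_lt_top).exists
  have : Integrable (fun x => f x - fn n x) μ := ⟨hf.sub (hfn n).aestronglyMeasurable, hn⟩
  exact (this.add (hfn n)).congr (ae_of_all _ fun t => by simp)

lemma exists_enorm_le_of_hasCompactSupport {F : Type*} [NormedAddCommGroup F]
    {g : EuclideanSpace ℝ (Fin N) → F}
    (hg : Continuous g) (hc : HasCompactSupport g) : ∃ C : ℝ≥0, ∀ x, ‖g x‖ₑ ≤ C := by
  obtain ⟨C, hC⟩ := hc.exists_bound_of_continuous hg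
  refine ⟨C.toNNReal, fun x => ?_⟩
  rw [← ofReal_norm]
  exact ENNReal.ofReal_le_ofReal (hC x)

lemma hasWeakGradient_of_tendsto {u : EuclideanSpace ℝ (Fin N) → ℝ}
    {G : EuclideanSpace ℝ (Fin N) → EuclideanSpace ℝ (Fin N)}
    {φ : ℕ → EuclideanSpace ℝ (Fin N) → ℝ} (hφ : ∀ n, IsTestFunction Ω (φ n))
    (hu : AEStronglyMeasurable u (volume.restrict Ω))
    (hG : AEStronglyMeasurable G (volume.restrict Ω))
    (h1 : Tendsto (fun n => ∫⁻ x in Ω, ‖u x - φ n x‖ₑ) atTop (𝓝 0))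
    (h2 : Tendsto (fun n => ∫⁻ x in Ω, ‖G x - gradient (φ n) x‖ₑ) atTop (𝓝 0)) :
    IntegrableOn u Ω ∧ IntegrableOn G Ω ∧ HasWeakGradient Ω u G := by
  have hui : IntegrableOn u Ω := integrable_of_tendsto_lintegral hu
    (fun n => ((hφ n).1.continuous.integrable_of_hasCompactSupport (hφ n).2.1).integrableOn) h1
  have hGi : IntegrableOn G Ω := integrable_of_tendsto_lintegral hG
    (fun n => ((continuous_gradient (hφ n).1).integrable_of_hasCompactSupport
      (hasCompactSupport_gradient (hφ n).2.1)).integrableOn) h2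
  refine ⟨hui, hGi, hui.locallyIntegrableOn, hGi.locallyIntegrableOn, fun ψ hψ => ?_⟩
  obtain ⟨C₁, hC₁⟩ := exists_enorm_le_of_hasCompactSupport (continuous_gradient hψ.1)
    (hasCompactSupport_gradient hψ.2.1)
  obtain ⟨C₂, hC₂⟩ := exists_enorm_le_of_hasCompactSupport hψ.1.continuous hψ.2.1
  have l1 : Tendsto (fun n => ∫ x in Ω, φ n x • gradient ψ x) atTop
      (𝓝 (∫ x in Ω, u x • gradient ψ x)) := by
    refine tendsto_integral_of_lintegral_le (C := C₁)
      (hu.smul (continuous_gradient hψ.1).aestronglyMeasurable)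
      (fun n => ?_) (fun n x => ?_) h1
    · exact (((hφ n).1.continuous.smul
        (continuous_gradient hψ.1)).integrable_of_hasCompactSupport
        (hφ n).2.1.smul_right).integrableOn
    · rw [← sub_smul, enorm_smul, mul_comm, enorm_sub_rev]
      gcongr
      exact hC₁ x
  have l2 : Tendsto (fun n => ∫ x in Ω, ψ x • gradient (φ n) x) atTop
      (𝓝 (∫ x in Ω, ψ x • G x)) := by
    refine tendsto_integral_of_lintegral_le (C := C₂)
      (hψ.1.continuous.aestronglyMeasurable.smul hG) (fun n => ?_) (fun n x => ?_) h2
    · exact ((hψ.1.continuous.smul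
        (continuous_gradient (hφ n).1)).integrable_of_hasCompactSupport
        hψ.2.1.smul_right).integrableOn
    · rw [← smul_sub, enorm_smul, enorm_sub_rev]
      gcongr
      exact hC₂ x
  refine tendsto_nhds_unique l1 (l2.neg.congr fun n => ?_)
  rw [setIntegral_smul_gradient_eq_neg (hφ n) hψ]

lemma HasWeakGradient.ae_eq (hΩ : IsOpen Ω) {u : EuclideanSpace ℝ (Fin N) → ℝ}
    {G G' : EuclideanSpace ℝ (Fin N) → EuclideanSpace ℝ (Fin N)}
    (h : HasWeakGradient Ω u G) (h' : HasWeakGradient Ω u G') :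
    G =ᵐ[volume.restrict Ω] G' := by
  have key := hΩ.ae_eq_zero_of_integral_contDiff_smul_eq_zero (μ := volume)
    (f := fun x => G x - G' x) (h.2.1.sub h'.2.1) ?_
  · rw [EventuallyEq, ae_restrict_iff' hΩ.measurableSet]
    filter_upwards [key] with x hx hxΩ using sub_eq_zero.1 (hx hxΩ)
  · intro ψ hψ hψc hψs
    have hψt : IsTestFunction Ω ψ := ⟨hψ, hψc, hψs⟩
    have hint : ∀ {H : EuclideanSpace ℝ (Fin N) → EuclideanSpace ℝ (Fin N)},
        LocallyIntegrableOn H Ω → IntegrableOn (fun x => ψ x • H x) Ω := by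
      intro H hH
      have h1 : IntegrableOn (fun x => ψ x • H x) (tsupport ψ) :=
        (hH.integrableOn_compact_subset hψs hψc).continuousOn_smul hψ.continuous.continuousOn hψc
      refine (h1.integrable_of_forall_notMem_eq_zero fun x hx => ?_).integrableOn
      rw [image_eq_zero_of_notMem_tsupport hx, zero_smul]
    have h3 := (h.2.2 ψ hψt).symm.trans (h'.2.2 ψ hψt)
    rw [← setIntegral_eq_integral_of_forall_compl_eq_zero (s := Ω)]
    · simp only [smul_sub]
      rw [integral_sub (hint h.2.1) (hint h'.2.1), neg_injective h3, sub_self]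
    · intro x hx
      rw [image_eq_zero_of_notMem_tsupport fun hx' => hx (hψs hx'), zero_smul]

lemma HasWeakGradient.weakGradient_ae_eq (hΩ : IsOpen Ω) {u : EuclideanSpace ℝ (Fin N) → ℝ}
    {G : EuclideanSpace ℝ (Fin N) → EuclideanSpace ℝ (Fin N)} (h : HasWeakGradient Ω u G) :
    weakGradient Ω u =ᵐ[volume.restrict Ω] G := by
  have hex : ∃ G, HasWeakGradient Ω u G := ⟨G, h⟩
  rw [weakGradient, dif_pos hex]
  exact hex.choose_spec.ae_eq hΩ h

/-- A limit of test functions in the norm of `W^{1,1}` belongs to `W^{1,1}_0`, and its weak gradient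
is the limit of the gradients. -/
lemma memW11Zero_of_tendsto (hΩ : IsOpen Ω) {u : EuclideanSpace ℝ (Fin N) → ℝ}
    {G : EuclideanSpace ℝ (Fin N) → EuclideanSpace ℝ (Fin N)}
    {φ : ℕ → EuclideanSpace ℝ (Fin N) → ℝ} (hφ : ∀ n, IsTestFunction Ω (φ n))
    (hu : AEStronglyMeasurable u (volume.restrict Ω))
    (hG : AEStronglyMeasurable G (volume.restrict Ω))
    (h1 : Tendsto (fun n => ∫⁻ x in Ω, ‖u x - φ n x‖ₑ) atTop (𝓝 0))
    (h2 : Tendsto (fun n => ∫⁻ x in Ω, ‖G x - gradient (φ n) x‖ₑ) atTop (𝓝 0)) :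
    MemW11Zero Ω u ∧ weakGradient Ω u =ᵐ[volume.restrict Ω] G := by
  obtain ⟨hui, hGi, hw⟩ := hasWeakGradient_of_tendsto hφ hu hG h1 h2
  have hae := hw.weakGradient_ae_eq hΩ
  refine ⟨⟨⟨hui, ⟨G, hw⟩, hGi.congr_fun_ae hae.symm⟩, φ, hφ, h1, h2.congr fun n => ?_⟩, hae⟩
  exact lintegral_congr_ae (by filter_upwards [hae] with x hx; rw [hx])

/-! ### Radial functions -/

lemma quasiMeasurePreserving_norm_ball (hN : 1 ≤ N) (R : ℝ) :
    Measure.QuasiMeasurePreserving (norm : EuclideanSpace ℝ (Fin N) → ℝ)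
      (volume.restrict (Metric.ball 0 R)) (volume.restrict (Ioo 0 R)) := by
  refine ⟨measurable_norm, ?_⟩
  rw [map_norm_ball hN]
  exact Measure.AbsolutelyContinuous.smul_left (radialMeasure_absolutelyContinuous N R) _

lemma IsNormalIntegrand.aemeasurable_comp {R : ℝ} {f : ℝ → ℝ → ℝ → EReal}
    (hf : IsNormalIntegrand R f) {α : Type*} [MeasurableSpace α] {μ : Measure α} {ρ τ ς : α → ℝ}
    (hρ : Measure.QuasiMeasurePreserving ρ μ (volume.restrict (Ioo 0 R)))
    (hτ : AEMeasurable τ μ) (hς : AEMeasurable ς μ) (h0 : ∀ a, 0 ≤ ς a) :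
    AEMeasurable (fun a => f (ρ a) (τ a) (ς a)) μ := by
  obtain ⟨g, hgm, -, hg⟩ := hf.borel
  refine (hgm.comp_aemeasurable (hρ.measurable.aemeasurable.prodMk (hτ.prodMk hς))).congr ?_
  filter_upwards [hρ.ae (ae_restrict_of_ae_restrict_of_subset Ioo_subset_Icc_self hg)] with a ha
  exact ha _ _ (h0 a)

/-- Smooth functions with compact support in `]0,R[` are dense in `L¹` of the radial measure. -/
lemma exists_testFunction_seq_tendsto {R : ℝ} (hR : 0 < R) {g : ℝ → ℝ}
    (hg : Integrable g (radialMeasure N R)) :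
    ∃ γ : ℕ → ℝ → ℝ, (∀ n, ContDiff ℝ ∞ (γ n) ∧ HasCompactSupport (γ n) ∧
        tsupport (γ n) ⊆ Ioo 0 R) ∧
      Tendsto (fun n => ∫⁻ r, ‖g r - γ n r‖ₑ ∂(radialMeasure N R)) atTop (𝓝 0) := by
  have hrad : ∀ᵐ r ∂(radialMeasure N R), r ∈ Ioo 0 R :=
    (radialMeasure_absolutelyContinuous N R).ae_le (ae_restrict_mem measurableSet_Ioo)
  -- cut-off functions which increase to the indicator of `]0,R[`
  have hδ : ∀ k : ℕ, 0 < R / (2 * (k + 2)) ∧ R / (2 * (k + 2)) < R / 2 := fun k => by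
    constructor
    · positivity
    · rw [div_lt_div_iff_of_pos_left hR (by positivity) (by positivity)]
      linarith [(Nat.cast_nonneg k : (0 : ℝ) ≤ k)]
  let χ : ∀ k : ℕ, ContDiffBump (R / 2) := fun k =>
    { rIn := R / 2 - R / (2 * (k + 2))
      rOut := R / 2 - R / (2 * (k + 2)) / 2
      rIn_pos := by linarith [hδ k]
      rIn_lt_rOut := by linarith [hδ k] }
  have hχs : ∀ k, tsupport (χ k) ⊆ Ioo 0 R := by
    intro k
    rw [(χ k).tsupport_eq, Real.closedBall_eq_Icc]
    intro x hx
    have h1 : (χ k).rOut = R / 2 - R / (2 * (k + 2)) / 2 := rfl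
    rw [h1] at hx
    constructor <;> linarith [hx.1, hx.2, hδ k]
  have hχ1 : ∀ x ∈ Ioo 0 R, Tendsto (fun k => χ k x) atTop (𝓝 1) := by
    intro x hx
    have h1 : Tendsto (fun k : ℕ => R / (2 * ((k : ℝ) + 2))) atTop (𝓝 0) := by
      refine Tendsto.div_atTop tendsto_const_nhds ?_
      exact Tendsto.const_mul_atTop two_pos
        (tendsto_atTop_add_const_right _ _ tendsto_natCast_atTop_atTop)
    have h2 : 0 < R / 2 - |x - R / 2| := by
      rw [sub_pos, abs_lt]
      constructor <;> linarith [hx.1, hx.2]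
    refine tendsto_const_nhds.congr' ?_
    filter_upwards [h1.eventually_lt_const h2] with k hk
    refine ((χ k).one_of_mem_closedBall ?_).symm
    rw [mem_closedBall_iff_norm, Real.norm_eq_abs]
    change |x - R / 2| ≤ R / 2 - R / (2 * (k + 2))
    linarith
  have key : ∀ n : ℕ, ∃ γ : ℝ → ℝ, (ContDiff ℝ ∞ γ ∧ HasCompactSupport γ ∧ tsupport γ ⊆ Ioo 0 R) ∧
      ∫⁻ r, ‖g r - γ r‖ₑ ∂(radialMeasure N R) ≤ ENNReal.ofReal (1 / (n + 1)) +
        ENNReal.ofReal (1 / (n + 1)) := by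
    intro n
    have hn : (0 : ℝ) < 1 / (n + 1) := by positivity
    obtain ⟨h, hhc, hhs, hhg⟩ := MemLp.exist_eLpNorm_sub_le ENNReal.one_ne_top le_rfl
      (memLp_one_iff_integrable.2 hg) hn
    have hcut : Tendsto (fun k => ∫⁻ r, ‖h r - χ k r * h r‖ₑ ∂(radialMeasure N R)) atTop (𝓝 0) := by
      have := tendsto_lintegral_of_dominated_convergence (μ := radialMeasure N R)
        (F := fun k r => ‖h r - χ k r * h r‖ₑ) (f := fun _ => 0) (fun r => ‖h r‖ₑ)
        (fun k => ((hhs.continuous.sub ((χ k).continuous.mul hhs.continuous)).enorm).measurable)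
        (fun k => ae_of_all _ fun r => ?_)
        (hhs.continuous.integrable_of_hasCompactSupport hhc).2.ne ?_
      · simpa using this
      · beta_reduce
        have h1 : h r - χ k r * h r = (1 - χ k r) * h r := by ring
        rw [h1, enorm_mul]
        refine mul_le_of_le_one_left bot_le ?_
        rw [← ofReal_norm, ENNReal.ofReal_le_one, Real.norm_eq_abs, abs_le]
        constructor <;> linarith [(χ k).nonneg (x := r), (χ k).le_one (x := r)]
      · filter_upwards [hrad] with r hr
        have h1 : Tendsto (fun k => h r - χ k r * h r) atTop (𝓝 (h r - 1 * h r)) :=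
          tendsto_const_nhds.sub ((hχ1 r hr).mul_const _)
        simpa using h1.enorm
    obtain ⟨k, hk⟩ := (hcut.eventually_lt_const (ENNReal.ofReal_pos.2 hn)).exists
    refine ⟨fun r => χ k r * h r, ⟨(χ k).contDiff.mul hhs, hhc.mul_left,
      (tsupport_mul_subset_left).trans (hχs k)⟩, ?_⟩
    rw [eLpNorm_one_eq_lintegral_enorm] at hhg
    calc ∫⁻ r, ‖g r - χ k r * h r‖ₑ ∂(radialMeasure N R)
        ≤ ∫⁻ r, (‖(g - h) r‖ₑ + ‖h r - χ k r * h r‖ₑ) ∂(radialMeasure N R) := by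
          refine lintegral_mono fun r => ?_
          have : g r - χ k r * h r = (g - h) r + (h r - χ k r * h r) := by simp
          rw [this]
          exact enorm_add_le _ _
      _ = ∫⁻ r, ‖(g - h) r‖ₑ ∂(radialMeasure N R) +
          ∫⁻ r, ‖h r - χ k r * h r‖ₑ ∂(radialMeasure N R) :=
          lintegral_add_right _
            ((hhs.continuous.sub ((χ k).continuous.mul hhs.continuous)).enorm).measurable
      _ ≤ _ := add_le_add hhg hk.le
  choose γ hγ hle using key
  refine ⟨γ, hγ, tendsto_of_tendsto_of_tendsto_of_le_of_le tendsto_const_nhds ?_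
    (fun _ => bot_le) hle⟩
  have := ENNReal.tendsto_ofReal tendsto_one_div_add_atTop_nhds_zero_nat
  simpa using this.add this

/-- If `γ` is smooth with compact support in `]0,R[` and `V` is its primitive vanishing at `R`, then
`x ↦ V(|x|)` is a test function on the ball of radius `R`. -/
lemma isTestFunction_radial {R : ℝ} {γ : ℝ → ℝ} (hγ : ContDiff ℝ ∞ γ)
    (hγc : HasCompactSupport γ) (hγs : tsupport γ ⊆ Ioo 0 R) :
    IsTestFunction (Metric.ball 0 R)
      (fun x : EuclideanSpace ℝ (Fin N) => - ∫ s in ‖x‖..R, γ s) ∧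
    ∀ x : EuclideanSpace ℝ (Fin N),
      gradient (fun x : EuclideanSpace ℝ (Fin N) => - ∫ s in ‖x‖..R, γ s) x =
        (γ ‖x‖ * ‖x‖⁻¹) • x := by
  set V : ℝ → ℝ := fun r => - ∫ s in r..R, γ s with hVdef
  have hV : ∀ r, HasDerivAt V (γ r) r := fun r => by
    have := (intervalIntegral.integral_hasDerivAt_left
      (hγ.continuous.intervalIntegrable r R) (hγ.continuous.stronglyMeasurableAtFilter _ _)
      hγ.continuous.continuousAt).neg
    rwa [neg_neg] at this
  have hVc : ContDiff ℝ ∞ V := by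
    rw [contDiff_infty_iff_deriv]
    refine ⟨fun r => (hV r).differentiableAt, ?_⟩
    rwa [show deriv V = γ from funext fun r => (hV r).deriv]
  obtain ⟨a, ha0, ha⟩ : ∃ a > 0, ∀ s ≤ a, γ s = 0 := by
    rcases (tsupport γ).eq_empty_or_nonempty with h | h
    · exact ⟨1, one_pos, fun s _ => image_eq_zero_of_notMem_tsupport (by simp [h])⟩
    · obtain ⟨m, hm, hmin⟩ := hγc.isCompact.exists_isLeast h
      refine ⟨m / 2, by linarith [(hγs hm).1], fun s hs => image_eq_zero_of_notMem_tsupport ?_⟩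
      intro h'
      linarith [hmin h', (hγs hm).1]
  obtain ⟨b, hb0, hb⟩ : ∃ b < R, ∀ s, b < s → γ s = 0 := by
    rcases (tsupport γ).eq_empty_or_nonempty with h | h
    · exact ⟨R - 1, by linarith, fun s _ => image_eq_zero_of_notMem_tsupport (by simp [h])⟩
    · obtain ⟨m, hm, hmax⟩ := hγc.isCompact.exists_isGreatest h
      refine ⟨m, (hγs hm).2, fun s hs => image_eq_zero_of_notMem_tsupport ?_⟩
      intro h'
      linarith [hmax h']
  have hVb : ∀ r, b < r → V r = 0 := fun r hr => by
    rw [hVdef, neg_eq_zero]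
    refine intervalIntegral.integral_zero_ae (ae_of_all _ fun s hs => hb s ?_)
    exact (lt_min hr hb0).trans hs.1
  have hVa : ∀ r ≤ a, V r = V a := fun r hr => by
    have := intervalIntegral.integral_add_adjacent_intervals
      (hγ.continuous.intervalIntegrable (μ := volume) r a) (hγ.continuous.intervalIntegrable a R)
    have h0 : ∫ s in r..a, γ s = 0 := by
      refine intervalIntegral.integral_zero_ae (ae_of_all _ fun s hs => ha s ?_)
      rw [uIoc_of_le hr] at hs
      exact hs.2
    rw [h0, zero_add] at this
    simp only [hVdef, this]
  have hloc : (fun x : EuclideanSpace ℝ (Fin N) => V ‖x‖) =ᶠ[𝓝 0] fun _ => V a := by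
    filter_upwards [Metric.ball_mem_nhds 0 ha0] with x hx
    exact hVa _ (by simpa using (mem_ball_zero_iff.1 hx).le)
  have hsupp : tsupport (fun x : EuclideanSpace ℝ (Fin N) => V ‖x‖) ⊆ Metric.closedBall 0 b := by
    refine closure_minimal (fun x hx => ?_) Metric.isClosed_closedBall
    by_contra h
    exact hx (hVb _ (by simpa using h))
  refine ⟨⟨?_, ?_, ?_⟩, fun x => ?_⟩
  · rw [contDiff_iff_contDiffAt]
    intro x
    rcases eq_or_ne x 0 with rfl | hx
    · exact contDiffAt_const.congr_of_eventuallyEq hloc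
    · exact hVc.contDiffAt.comp x (contDiffAt_norm ℝ hx)
  · exact (isCompact_closedBall _ _).of_isClosed_subset (isClosed_tsupport _) hsupp
  · exact hsupp.trans (Metric.closedBall_subset_ball hb0)
  · refine HasGradientAt.gradient ?_
    rcases eq_or_ne x 0 with rfl | hx
    · rw [smul_zero]
      refine HasGradientAt.congr_of_eventuallyEq ?_ hloc
      exact hasGradientAt_const _ _
    · have hx0 : ‖x‖ ≠ 0 := norm_ne_zero_iff.2 hx
      have hn : HasFDerivAt (fun y : EuclideanSpace ℝ (Fin N) => ‖y‖)
          (‖x‖⁻¹ • innerSL ℝ x) x := by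
        have h1 := (hasStrictFDerivAt_norm_sq x).hasFDerivAt.sqrt (by positivity)
        simp only [Real.sqrt_sq (norm_nonneg _)] at h1
        convert! h1 using 1
        ext y
        simp
        field_simp
      rw [hasGradientAt_iff_hasFDerivAt]
      convert! (hV ‖x‖).comp_hasFDerivAt x hn using 1
      ext y
      simp
      ring

lemma MemWrad.intervalIntegrable_deriv {R : ℝ} {v : ℝ → ℝ} (hv : MemWrad N R v) {r : ℝ}
    (hr : r ∈ Ioc 0 R) : IntervalIntegrable (deriv v) volume r R :=
  (hv.1 r hr).intervalIntegrable_deriv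

lemma MemWrad.eq_neg_integral {R : ℝ} {v : ℝ → ℝ} (hv : MemWrad N R v) {r : ℝ}
    (hr : r ∈ Ioc 0 R) : v r = - ∫ s in r..R, deriv v s := by
  rw [(hv.1 r hr).integral_deriv_eq_sub, hv.2.1]
  ring

lemma MemWrad.aemeasurable {R : ℝ} {v : ℝ → ℝ} (hv : MemWrad N R v) :
    AEMeasurable v (volume.restrict (Ioo 0 R)) := by
  refine ContinuousOn.aemeasurable (fun r hr => ?_) measurableSet_Ioo
  have hc := (hv.1 (r / 2) ⟨by linarith [hr.1], by linarith [hr.1, hr.2]⟩).continuousOn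
  refine (hc.continuousAt ?_).continuousWithinAt
  rw [uIcc_of_le (by linarith [hr.1, hr.2])]
  exact Icc_mem_nhds (by linarith [hr.1]) hr.2

lemma MemWrad.integrable_deriv {R : ℝ} {v : ℝ → ℝ} (hv : MemWrad N R v) :
    Integrable (deriv v) (radialMeasure N R) := by
  refine ⟨(measurable_deriv v).aestronglyMeasurable, ?_⟩
  rw [HasFiniteIntegral, lintegral_radialMeasure]
  refine lt_of_le_of_lt (setLIntegral_mono' measurableSet_Ioo fun r hr => ?_) hv.2.2.2
  rw [enorm_mul, Real.enorm_abs]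
  gcongr
  rw [Real.enorm_eq_ofReal (pow_nonneg hr.1.le _)]

/-- `r^{N-1} |v(r) - V(r)|` is at most the weighted `L¹` distance of the derivatives, because the
weight `r^{N-1}` increases. -/
lemma MemWrad.weight_mul_enorm_sub_le {R : ℝ} {v γ : ℝ → ℝ} (hv : MemWrad N R v)
    (hγ : Continuous γ) {r : ℝ} (hr : r ∈ Ioo 0 R) :
    ENNReal.ofReal (r ^ (N - 1)) * ‖v r - (- ∫ s in r..R, γ s)‖ₑ ≤
      ∫⁻ s, ‖deriv v s - γ s‖ₑ ∂(radialMeasure N R) := by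
  have h1 : v r - (- ∫ s in r..R, γ s) = - ∫ s in Ioc r R, (deriv v s - γ s) := by
    rw [hv.eq_neg_integral (Ioo_subset_Ioc_self hr), ← intervalIntegral.integral_of_le hr.2.le,
      intervalIntegral.integral_sub (hv.intervalIntegrable_deriv (Ioo_subset_Ioc_self hr))
        (hγ.intervalIntegrable _ _)]
    ring
  rw [h1, enorm_neg, lintegral_radialMeasure]
  calc ENNReal.ofReal (r ^ (N - 1)) * ‖∫ s in Ioc r R, (deriv v s - γ s)‖ₑ
      ≤ ENNReal.ofReal (r ^ (N - 1)) * ∫⁻ s in Ioc r R, ‖deriv v s - γ s‖ₑ := by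
        gcongr
        exact enorm_integral_le_lintegral_enorm _
    _ = ∫⁻ s in Ioo r R, ENNReal.ofReal (r ^ (N - 1)) * ‖deriv v s - γ s‖ₑ := by
        rw [lintegral_const_mul' _ _ ENNReal.ofReal_ne_top, restrict_Ioo_eq_restrict_Ioc]
    _ ≤ ∫⁻ s in Ioo r R, ENNReal.ofReal (s ^ (N - 1)) * ‖deriv v s - γ s‖ₑ := by
        refine setLIntegral_mono' measurableSet_Ioo fun s hs => ?_
        have := hr.1.le
        have := hs.1.le
        gcongr
    _ ≤ _ := lintegral_mono_set (Ioo_subset_Ioo_left hr.1.le)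

lemma MemWrad.memW11Zero {R : ℝ} (hN : 1 ≤ N) (hR : 0 < R) {v : ℝ → ℝ} (hv : MemWrad N R v) :
    MemW11Zero (Metric.ball 0 R) (fun x : EuclideanSpace ℝ (Fin N) => v ‖x‖) ∧
      weakGradient (Metric.ball 0 R) (fun x : EuclideanSpace ℝ (Fin N) => v ‖x‖)
        =ᵐ[volume.restrict (Metric.ball 0 R)] fun x => (deriv v ‖x‖ * ‖x‖⁻¹) • x := by
  obtain ⟨γ, hγ, hlim⟩ := exists_testFunction_seq_tendsto hR hv.integrable_deriv
  have htest := fun n => isTestFunction_radial (N := N) (hγ n).1 (hγ n).2.1 (hγ n).2.2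
  have hVm : ∀ n, Continuous fun r => - ∫ s in r..R, γ n s := fun n => by
    have := intervalIntegral.continuous_primitive
      (fun a b => (hγ n).1.continuous.intervalIntegrable (μ := volume) a b) R
    simpa only [intervalIntegral.integral_symm R, neg_neg] using this
  refine memW11Zero_of_tendsto Metric.isOpen_ball (fun n => (htest n).1) ?_ ?_ ?_ ?_
  · exact (hv.aemeasurable.comp_quasiMeasurePreserving
      (quasiMeasurePreserving_norm_ball hN R)).aestronglyMeasurable
  · have := measurable_deriv v
    fun_prop
  · have h1 : ∀ n, ∫⁻ x in Metric.ball (0 : EuclideanSpace ℝ (Fin N)) R,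
        ‖v ‖x‖ - (- ∫ s in ‖x‖..R, γ n s)‖ₑ ≤
        sphereArea N * ((∫⁻ s, ‖deriv v s - γ n s‖ₑ ∂(radialMeasure N R)) *
          volume (Ioo 0 R)) := by
      intro n
      rw [lintegral_ball_norm hN R (g := fun r => ‖v r - (- ∫ s in r..R, γ n s)‖ₑ)
        (hv.aemeasurable.sub (hVm n).measurable.aemeasurable).enorm]
      gcongr
      rw [lintegral_radialMeasure, ← setLIntegral_const]
      exact setLIntegral_mono' measurableSet_Ioo fun r hr =>
        hv.weight_mul_enorm_sub_le (hγ n).1.continuous hr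
    refine tendsto_of_tendsto_of_tendsto_of_le_of_le tendsto_const_nhds ?_ (fun _ => bot_le) h1
    have h2 := ENNReal.Tendsto.mul_const (b := volume (Ioo 0 R)) hlim (Or.inr (by simp))
    have h3 := ENNReal.Tendsto.const_mul (a := sphereArea N) h2 (Or.inr sphereArea_ne_top)
    simpa using h3
  · have h1 : ∀ n, ∫⁻ x in Metric.ball (0 : EuclideanSpace ℝ (Fin N)) R,
        ‖(deriv v ‖x‖ * ‖x‖⁻¹) • x -
          gradient (fun x : EuclideanSpace ℝ (Fin N) => - ∫ s in ‖x‖..R, γ n s) x‖ₑ ≤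
        sphereArea N * ∫⁻ s, ‖deriv v s - γ n s‖ₑ ∂(radialMeasure N R) := by
      intro n
      rw [← lintegral_ball_norm hN R (g := fun s => ‖deriv v s - γ n s‖ₑ)
        ((measurable_deriv v).sub (hγ n).1.continuous.measurable).enorm.aemeasurable]
      refine lintegral_mono fun x => ?_
      rw [(htest n).2, ← sub_smul, ← sub_mul, mul_smul, enorm_smul]
      refine mul_le_of_le_one_right bot_le ?_
      rw [← ofReal_norm, norm_smul, norm_inv, norm_norm, ENNReal.ofReal_le_one]
      exact inv_mul_le_one
    refine tendsto_of_tendsto_of_tendsto_of_le_of_le tendsto_const_nhds ?_ (fun _ => bot_le) h1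
    simpa using ENNReal.Tendsto.const_mul (a := sphereArea N) hlim (Or.inr sphereArea_ne_top)

/-- Radial functions: the two functionals agree up to the area of the sphere. -/
lemma MemWrad.energy_eq {R : ℝ} (hN : 1 ≤ N) (hR : 0 < R) {f : ℝ → ℝ → ℝ → EReal}
    (hf : IsNormalIntegrand R f) {v : ℝ → ℝ} (hv : MemWrad N R v) :
    energy N R f (fun x : EuclideanSpace ℝ (Fin N) => v ‖x‖) =
      (sphereArea N : EReal) * radialEnergy N R f v := by
  have hH : AEMeasurable (fun r => f r (v r) |deriv v r|) (volume.restrict (Ioo 0 R)) :=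
    hf.aemeasurable_comp (Measure.QuasiMeasurePreserving.id _) hv.aemeasurable
      (measurable_deriv v).norm.aemeasurable (fun _ => abs_nonneg _)
  rw [radialEnergy_eq, ← extIntegral_smul_measure (sphereArea_ne_zero hN) sphereArea_ne_top,
    ← map_norm_ball hN, extIntegral_map measurable_norm.aemeasurable
      (hH.mono_ac (quasiMeasurePreserving_norm_ball hN R).absolutelyContinuous)]
  refine extIntegral_congr ?_
  have hpos : ∀ᵐ x ∂(volume.restrict (Metric.ball (0 : EuclideanSpace ℝ (Fin N)) R)),
      ‖x‖ ∈ Ioo 0 R :=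
    (quasiMeasurePreserving_norm_ball hN R).ae (ae_restrict_mem measurableSet_Ioo)
  filter_upwards [(hv.memW11Zero hN hR).2, hpos] with x hx hx0
  rw [hx, norm_smul, norm_mul, norm_inv, norm_norm, Real.norm_eq_abs,
    inv_mul_cancel_right₀ hx0.1.ne']

/-! ### Restriction of Sobolev functions to rays -/

/-- Measurable versions of a function in `W^{1,1}_0` and of its weak gradient, together with
approximating test functions. -/
lemma MemW11Zero.exists_measurable {Ω : Set (EuclideanSpace ℝ (Fin N))}
    {u : EuclideanSpace ℝ (Fin N) → ℝ} (hu : MemW11Zero Ω u) :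
    ∃ (u₀ : EuclideanSpace ℝ (Fin N) → ℝ)
      (G₀ : EuclideanSpace ℝ (Fin N) → EuclideanSpace ℝ (Fin N))
      (φ : ℕ → EuclideanSpace ℝ (Fin N) → ℝ),
      Measurable u₀ ∧ Measurable G₀ ∧ u =ᵐ[volume.restrict Ω] u₀ ∧
      weakGradient Ω u =ᵐ[volume.restrict Ω] G₀ ∧ (∀ n, IsTestFunction Ω (φ n)) ∧
      Tendsto (fun n => ∫⁻ x in Ω, (‖u₀ x - φ n x‖ₑ + ‖G₀ x - gradient (φ n) x‖ₑ)) atTop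
        (𝓝 0) := by
  obtain ⟨⟨hui, -, hGi⟩, φ, hφ, h1, h2⟩ := hu
  have hum := hui.aestronglyMeasurable
  have hGm := hGi.aestronglyMeasurable
  refine ⟨hum.mk u, hGm.mk _, φ, hum.stronglyMeasurable_mk.measurable,
    hGm.stronglyMeasurable_mk.measurable, hum.ae_eq_mk, hGm.ae_eq_mk, hφ, ?_⟩
  have h3 := h1.add h2
  rw [add_zero] at h3
  refine h3.congr fun n => ?_
  rw [← lintegral_add_left']
  · refine lintegral_congr_ae ?_
    filter_upwards [hum.ae_eq_mk, hGm.ae_eq_mk] with x hx hx'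
    rw [hx, hx']
  · exact (hum.sub (hφ n).1.continuous.aestronglyMeasurable).enorm

lemma measurable_approximation_error {u₀ : EuclideanSpace ℝ (Fin N) → ℝ}
    {G₀ : EuclideanSpace ℝ (Fin N) → EuclideanSpace ℝ (Fin N)} (hu : Measurable u₀)
    (hG : Measurable G₀) {Ω : Set (EuclideanSpace ℝ (Fin N))}
    {φ : EuclideanSpace ℝ (Fin N) → ℝ} (hφ : IsTestFunction Ω φ) :
    Measurable fun x => ‖u₀ x - φ x‖ₑ + ‖G₀ x - gradient φ x‖ₑ :=
  (hu.sub hφ.1.continuous.measurable).enorm.add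
    (hG.sub (continuous_gradient hφ.1).measurable).enorm

lemma integrableOn_pow_mul_abs_of_integrable {R : ℝ} {g : ℝ → ℝ} (hgm : Measurable g)
    (hg : Integrable g (radialMeasure N R)) :
    IntegrableOn (fun r => r ^ (N - 1) * |g r|) (Ioo 0 R) := by
  refine ⟨by fun_prop, ?_⟩
  have h := hg.2
  rw [HasFiniteIntegral, lintegral_radialMeasure] at h
  refine lt_of_le_of_lt (setLIntegral_mono' measurableSet_Ioo fun r hr => ?_) h
  rw [enorm_mul, Real.enorm_abs, Real.enorm_eq_ofReal (pow_nonneg hr.1.le _)]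

/-- On almost every ray a function of `W^{1,1}_0` of the ball coincides with an element of `W_rad`,
whose derivative is the radial component of the gradient. -/
lemma ae_exists_memWrad_ray (hN : 1 ≤ N) {R : ℝ} (hR : 0 < R)
    {u₀ : EuclideanSpace ℝ (Fin N) → ℝ}
    {G₀ : EuclideanSpace ℝ (Fin N) → EuclideanSpace ℝ (Fin N)} (hu : Measurable u₀)
    (hG : Measurable G₀) {φ : ℕ → EuclideanSpace ℝ (Fin N) → ℝ}
    (hφ : ∀ n, IsTestFunction (Metric.ball 0 R) (φ n))
    (hlim : Tendsto (fun n => ∫⁻ x in Metric.ball 0 R,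
      (‖u₀ x - φ n x‖ₑ + ‖G₀ x - gradient (φ n) x‖ₑ)) atTop (𝓝 0)) :
    ∀ᵐ θ ∂(volume : Measure (EuclideanSpace ℝ (Fin N))).toSphere, ∃ v, MemWrad N R v ∧
      ∀ᵐ r ∂(volume.restrict (Ioo 0 R)),
        v r = u₀ (r • θ.1) ∧ deriv v r = inner ℝ (G₀ (r • θ.1)) θ.1 := by
  have hpol := measurePreserving_polar hN R
  have herr := fun n => measurable_approximation_error hu hG (hφ n)
  obtain ⟨ns, hns, hslice⟩ := exists_subseq_slice_tendsto
    (μ := (volume : Measure (EuclideanSpace ℝ (Fin N))).toSphere) (ν := radialMeasure N R)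
    (h := fun n p => ‖u₀ (p.2 • p.1.1) - φ n (p.2 • p.1.1)‖ₑ +
      ‖G₀ (p.2 • p.1.1) - gradient (φ n) (p.2 • p.1.1)‖ₑ)
    (fun n => ((herr n).comp hpol.measurable).aemeasurable)
    (hlim.congr fun n => (hpol.lintegral_comp (herr n)).symm)
  filter_upwards [hslice] with θ hθ
  have hθ1 : ‖θ.1‖ = 1 := by simp
  set g : ℝ → ℝ := fun r => inner ℝ (G₀ (r • θ.1)) θ.1 with hgdef
  set w : ℝ → ℝ := fun r => u₀ (r • θ.1) with hwdef
  have hgm : Measurable g := by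
    have : Measurable fun r : ℝ => G₀ (r • θ.1) := hG.comp (by fun_prop)
    fun_prop
  have hwm : Measurable w := hu.comp (by fun_prop)
  set ψ : ℕ → ℝ → ℝ := fun k r => φ (ns k) (r • θ.1) with hψdef
  set ψ' : ℕ → ℝ → ℝ := fun k r => inner ℝ (gradient (φ (ns k)) (r • θ.1)) θ.1 with hψ'def
  have hψ : ∀ k t, HasDerivAt (ψ k) (ψ' k t) t := by
    intro k t
    have h1 : HasDerivAt (fun r : ℝ => r • θ.1) θ.1 t := by
      simpa using (hasDerivAt_id t).smul_const θ.1
    have h2 := (((hφ (ns k)).1.differentiable (by simp)) (t • θ.1)).hasFDerivAt.comp_hasDerivAt t h1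
    simp only [hψ'def, inner_gradient]
    exact h2
  have hψ'c : ∀ k, Continuous (ψ' k) := fun k => by
    have := continuous_gradient (hφ (ns k)).1
    simp only [hψ'def]
    fun_prop
  have hψR : ∀ k, ψ k R = 0 := fun k => by
    refine image_eq_zero_of_notMem_tsupport (f := φ (ns k)) fun h => ?_
    have := mem_ball_zero_iff.1 ((hφ (ns k)).2.2 h)
    rw [norm_smul, hθ1, Real.norm_eq_abs, abs_of_pos hR] at this
    linarith
  have hgψ : ∀ k r, ‖g r - ψ' k r‖ₑ ≤ ‖G₀ (r • θ.1) - gradient (φ (ns k)) (r • θ.1)‖ₑ := by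
    intro k r
    simp only [hgdef, hψ'def]
    rw [← inner_sub_left, enorm_le_iff_norm_le]
    simpa [hθ1] using norm_inner_le_norm (𝕜 := ℝ)
      (G₀ (r • θ.1) - gradient (φ (ns k)) (r • θ.1)) θ.1
  have hg0 : Tendsto (fun k => ∫⁻ r, ‖g r - ψ' k r‖ₑ ∂(radialMeasure N R)) atTop (𝓝 0) :=
    tendsto_of_tendsto_of_tendsto_of_le_of_le tendsto_const_nhds hθ (fun _ => bot_le)
      fun k => lintegral_mono fun r => (hgψ k r).trans le_add_self
  have hw0 : Tendsto (fun k => ∫⁻ r, ‖w r - ψ k r‖ₑ ∂(radialMeasure N R)) atTop (𝓝 0) :=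
    tendsto_of_tendsto_of_tendsto_of_le_of_le tendsto_const_nhds hθ (fun _ => bot_le)
      fun k => lintegral_mono fun r => le_self_add
  -- away from the origin the weight is bounded below
  have hunweight : ∀ a ∈ Ioo 0 R, ∀ e : ℕ → ℝ → ℝ≥0∞,
      Tendsto (fun k => ∫⁻ r, e k r ∂(radialMeasure N R)) atTop (𝓝 0) →
      Tendsto (fun k => ∫⁻ r in Ioc a R, e k r) atTop (𝓝 0) := by
    intro a ha e he
    have hpos : ENNReal.ofReal (a ^ (N - 1)) ≠ 0 := by
      simpa using pow_pos ha.1 _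
    have h1 : ∀ k, ∫⁻ r in Ioc a R, e k r ≤
        (ENNReal.ofReal (a ^ (N - 1)))⁻¹ * ∫⁻ r, e k r ∂(radialMeasure N R) := by
      intro k
      rw [← ENNReal.mul_le_iff_le_inv hpos ENNReal.ofReal_ne_top,
        ← lintegral_const_mul' _ _ ENNReal.ofReal_ne_top, lintegral_radialMeasure,
        ← restrict_Ioo_eq_restrict_Ioc]
      refine (setLIntegral_mono' measurableSet_Ioo fun r hr => ?_).trans
        (lintegral_mono_set (Ioo_subset_Ioo_left ha.1.le))
      have := hr.1.le
      have := ha.1.le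
      gcongr
    refine tendsto_of_tendsto_of_tendsto_of_le_of_le tendsto_const_nhds ?_ (fun _ => bot_le) h1
    simpa using ENNReal.Tendsto.const_mul (a := (ENNReal.ofReal (a ^ (N - 1)))⁻¹) he
      (Or.inr (ENNReal.inv_ne_top.2 hpos))
  have hprim : ∀ a ∈ Ioo 0 R, IntervalIntegrable g volume a R ∧
      ∀ᵐ t ∂(volume.restrict (Ioc a R)), w t = ∫ s in R..t, g s := by
    intro a ha
    obtain ⟨hgi, C, hC, hC0⟩ := ae_eq_sub_integral_of_tendsto ha.2 hψ hψ'c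
      hwm.aestronglyMeasurable hgm.aestronglyMeasurable (hunweight a ha _ hw0)
      (hunweight a ha _ hg0)
    refine ⟨hgi, hC.mono fun t ht => ?_⟩
    rw [ht, hC0 hψR, zero_sub, intervalIntegral.integral_symm, neg_neg]
  have hall : ∀ᵐ r ∂(volume.restrict (Ioo 0 R)),
      ∫ s in R..r, g s = w r ∧ deriv (fun r => ∫ s in R..r, g s) r = g r := by
    have hloc : ∀ k : ℕ, ∀ᵐ r : ℝ, r ∈ Ioc (R / (k + 2)) R →
        ∫ s in R..r, g s = w r ∧ deriv (fun r => ∫ s in R..r, g s) r = g r := by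
      intro k
      have hk : R / (k + 2) ∈ Ioo 0 R := by
        have : (0 : ℝ) ≤ k := Nat.cast_nonneg k
        refine ⟨by positivity, ?_⟩
        rw [div_lt_iff₀ (by positivity)]
        nlinarith
      obtain ⟨hgi, hw⟩ := hprim _ hk
      filter_upwards [(ae_restrict_iff' measurableSet_Ioc).1 hw, hgi.ae_hasDerivAt_integral]
        with r h1 h2 hr
      refine ⟨(h1 hr).symm, (h2 ?_ R right_mem_uIcc).deriv⟩
      rw [uIcc_of_le hk.2.le]
      exact Ioc_subset_Icc_self hr
    rw [ae_restrict_iff' measurableSet_Ioo]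
    filter_upwards [ae_all_iff.2 hloc] with r hr hrR
    obtain ⟨k, hk⟩ := exists_nat_gt (R / r)
    refine hr k ⟨?_, hrR.2.le⟩
    rw [div_lt_iff₀ hrR.1] at hk
    rw [div_lt_iff₀ (by positivity)]
    nlinarith [hrR.1]
  refine ⟨fun r => ∫ s in R..r, g s, ⟨fun a ha => ?_, by simp, ?_⟩, hall⟩
  · rcases ha.2.eq_or_lt with rfl | h
    · refine IntervalIntegrable.absolutelyContinuousOnInterval_intervalIntegral ?_ (by simp)
      exact IntervalIntegrable.refl
    · exact (hprim a ⟨ha.1, h⟩).1.absolutelyContinuousOnInterval_intervalIntegral right_mem_uIcc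
  · have hgint : Integrable g (radialMeasure N R) := by
      refine integrable_of_tendsto_lintegral hgm.aestronglyMeasurable (fun k => ?_) hg0
      obtain ⟨C, hC⟩ := (hasCompactSupport_gradient (hφ (ns k)).2.1).exists_bound_of_continuous
        (continuous_gradient (hφ (ns k)).1)
      refine Integrable.of_bound (hψ'c k).aestronglyMeasurable C (ae_of_all _ fun r => ?_)
      refine (norm_inner_le_norm _ _).trans ?_
      rw [hθ1, mul_one]
      exact hC _
    refine (integrableOn_pow_mul_abs_of_integrable hgm hgint).congr_fun_ae ?_
    filter_upwards [hall] with r hr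
    rw [hr.2]

/-! ### Tangential derivatives on null sets of values -/

lemma measurePreserving_exp_skewAdjoint
    {A : EuclideanSpace ℝ (Fin N) →L[ℝ] EuclideanSpace ℝ (Fin N)}
    (hA : A ∈ skewAdjoint (EuclideanSpace ℝ (Fin N) →L[ℝ] EuclideanSpace ℝ (Fin N))) (t R : ℝ) :
    (∀ x, ‖NormedSpace.exp (t • A) x‖ = ‖x‖) ∧
    MeasurePreserving (fun x => NormedSpace.exp (t • A) x)
      (volume.restrict (Metric.ball (0 : EuclideanSpace ℝ (Fin N)) R))
      (volume.restrict (Metric.ball 0 R)) := by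
  let _ : NormedAlgebra ℚ (EuclideanSpace ℝ (Fin N) →L[ℝ] EuclideanSpace ℝ (Fin N)) :=
    NormedAlgebra.restrictScalars ℚ ℝ _
  have hU := NormedSpace.exp_mem_unitary_of_mem_skewAdjoint
    (skewAdjoint.smul_mem t hA)
  let L := Unitary.linearIsometryEquiv ⟨_, hU⟩
  have hL : ∀ x, L x = NormedSpace.exp (t • A) x := fun x => rfl
  have hnorm : ∀ x, ‖NormedSpace.exp (t • A) x‖ = ‖x‖ := fun x => by
    rw [← hL, L.norm_map]
  refine ⟨hnorm, ?_⟩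
  have h1 := L.measurePreserving.restrict_preimage
    (Metric.isOpen_ball (x := (0 : EuclideanSpace ℝ (Fin N))) (ε := R)).measurableSet
  have h2 : L ⁻¹' Metric.ball 0 R = Metric.ball 0 R := by
    ext x
    simp
  rwa [h2] at h1

/-- Let `A` be skew-adjoint. The derivative of a function `u` of `W^{1,1}_0` in the direction of the
tangential field `x ↦ A x` vanishes almost everywhere on `{x | (|x|, u x) ∈ Z}`, if almost every
section of `Z` is a null set. Indeed `|x|` is constant along the orbits `t ↦ exp(tA) x`, and along
almost every orbit `u` is the primitive of its derivative. -/
lemma ae_inner_skewAdjoint_eq_zero_or_notMem (hN : 1 ≤ N) {R : ℝ}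
    {u₀ : EuclideanSpace ℝ (Fin N) → ℝ}
    {G₀ : EuclideanSpace ℝ (Fin N) → EuclideanSpace ℝ (Fin N)} (hu : Measurable u₀)
    (hG : Measurable G₀) {φ : ℕ → EuclideanSpace ℝ (Fin N) → ℝ}
    (hφ : ∀ n, IsTestFunction (Metric.ball 0 R) (φ n))
    (hlim : Tendsto (fun n => ∫⁻ x in Metric.ball 0 R,
      (‖u₀ x - φ n x‖ₑ + ‖G₀ x - gradient (φ n) x‖ₑ)) atTop (𝓝 0))
    {A : EuclideanSpace ℝ (Fin N) →L[ℝ] EuclideanSpace ℝ (Fin N)}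
    (hA : A ∈ skewAdjoint (EuclideanSpace ℝ (Fin N) →L[ℝ] EuclideanSpace ℝ (Fin N)))
    {Z : Set (ℝ × ℝ)} (hZm : MeasurableSet Z)
    (hZ : ∀ᵐ r ∂(volume.restrict (Ioo 0 R)), volume {t | (r, t) ∈ Z} = 0) :
    ∀ᵐ x ∂(volume.restrict (Metric.ball 0 R)), inner ℝ (G₀ x) (A x) = 0 ∨ (‖x‖, u₀ x) ∉ Z := by
  set U : ℝ → EuclideanSpace ℝ (Fin N) →L[ℝ] EuclideanSpace ℝ (Fin N) :=
    fun t => NormedSpace.exp (t • A) with hU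
  have hUd : ∀ x t, HasDerivAt (fun t => U t x) (A (U t x)) t := fun x t =>
    (hasDerivAt_exp_smul_const' A t).clm_apply (hasDerivAt_const t x) |>.congr_deriv (by simp [hU])
  have hUc : Continuous U := continuous_iff_continuousAt.2 fun t =>
    (hasDerivAt_exp_smul_const' A t).continuousAt
  have hUj : Continuous fun p : EuclideanSpace ℝ (Fin N) × ℝ => U p.2 p.1 :=
    (hUc.comp continuous_snd).clm_apply continuous_fst
  have hUn : ∀ t x, ‖U t x‖ = ‖x‖ := fun t => (measurePreserving_exp_skewAdjoint hA t R).1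
  have hUp := fun t => (measurePreserving_exp_skewAdjoint hA t R).2
  have herr := fun n => measurable_approximation_error hu hG (hφ n)
  have hjoint : ∀ n, Measurable fun p : EuclideanSpace ℝ (Fin N) × ℝ =>
      ‖u₀ (U p.2 p.1) - φ n (U p.2 p.1)‖ₑ + ‖G₀ (U p.2 p.1) - gradient (φ n) (U p.2 p.1)‖ₑ :=
    fun n => (herr n).comp hUj.measurable
  obtain ⟨ns, hns, hslice⟩ := exists_subseq_slice_tendsto
    (μ := volume.restrict (Metric.ball (0 : EuclideanSpace ℝ (Fin N)) R))
    (ν := volume.restrict (Ioc (0 : ℝ) 1))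
    (h := fun n p => ‖u₀ (U p.2 p.1) - φ n (U p.2 p.1)‖ₑ +
      ‖G₀ (U p.2 p.1) - gradient (φ n) (U p.2 p.1)‖ₑ)
    (fun n => (hjoint n).aemeasurable) (hlim.congr fun n => by
      rw [lintegral_prod_symm _ (hjoint n).aemeasurable]
      have h1 : ∀ t, ∫⁻ x in Metric.ball (0 : EuclideanSpace ℝ (Fin N)) R,
          (‖u₀ (U t x) - φ n (U t x)‖ₑ + ‖G₀ (U t x) - gradient (φ n) (U t x)‖ₑ) =
          ∫⁻ x in Metric.ball 0 R, (‖u₀ x - φ n x‖ₑ + ‖G₀ x - gradient (φ n) x‖ₑ) :=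
        fun t => (hUp t).lintegral_comp (herr n)
      simp [h1])
  have horbit : ∀ᵐ x ∂(volume.restrict (Metric.ball (0 : EuclideanSpace ℝ (Fin N)) R)),
      ∀ᵐ t ∂(volume.restrict (Ioc (0 : ℝ) 1)),
        inner ℝ (G₀ (U t x)) (A (U t x)) = 0 ∨ (‖U t x‖, u₀ (U t x)) ∉ Z := by
    filter_upwards [hslice, ae_ball_of_ae_Ioo hN hZ] with x hx hxZ
    have hUx : Measurable fun t => U t x :=
      (hUc.clm_apply continuous_const).measurable
    have hbound : ∀ k t, ‖inner ℝ (G₀ (U t x)) (A (U t x)) -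
        inner ℝ (gradient (φ (ns k)) (U t x)) (A (U t x))‖ₑ ≤
        ‖‖A‖ * ‖x‖‖ₑ * ‖G₀ (U t x) - gradient (φ (ns k)) (U t x)‖ₑ := by
      intro k t
      rw [← inner_sub_left, ← enorm_norm (G₀ (U t x) - _), ← enorm_mul, enorm_le_iff_norm_le]
      refine (norm_inner_le_norm _ _).trans ?_
      rw [mul_comm, norm_mul, norm_mul, norm_norm, norm_norm, norm_norm]
      gcongr
      exact (A.le_opNorm _).trans_eq (by rw [hUn])
    have h1 : Tendsto (fun k => ∫⁻ t in Ioc (0 : ℝ) 1, ‖u₀ (U t x) - φ (ns k) (U t x)‖ₑ) atTop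
        (𝓝 0) :=
      tendsto_of_tendsto_of_tendsto_of_le_of_le tendsto_const_nhds hx (fun _ => bot_le)
        fun k => lintegral_mono fun t => le_self_add
    have h2 : Tendsto (fun k => ∫⁻ t in Ioc (0 : ℝ) 1, ‖inner ℝ (G₀ (U t x)) (A (U t x)) -
        inner ℝ (gradient (φ (ns k)) (U t x)) (A (U t x))‖ₑ) atTop (𝓝 0) := by
      refine tendsto_of_tendsto_of_tendsto_of_le_of_le tendsto_const_nhds
        (h := fun k => ‖‖A‖ * ‖x‖‖ₑ * ∫⁻ t in Ioc (0 : ℝ) 1, (‖u₀ (U t x) - φ (ns k) (U t x)‖ₑ +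
          ‖G₀ (U t x) - gradient (φ (ns k)) (U t x)‖ₑ)) ?_ (fun _ => bot_le) fun k => ?_
      · simpa using ENNReal.Tendsto.const_mul hx (Or.inr (enorm_ne_top (x := ‖A‖ * ‖x‖)))
      · beta_reduce
        rw [← lintegral_const_mul' _ _ enorm_ne_top]
        refine lintegral_mono fun t => (hbound k t).trans ?_
        gcongr
        exact le_add_self
    have h3 := ae_deriv_eq_zero_or_notMem_of_tendsto (one_pos (α := ℝ))
      (φ := fun k t => φ (ns k) (U t x))
      (φ' := fun k t => inner ℝ (gradient (φ (ns k)) (U t x)) (A (U t x)))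
      (v := fun t => u₀ (U t x)) (g := fun t => inner ℝ (G₀ (U t x)) (A (U t x)))
      (fun k t => ?_) (fun k => ?_) (hu.comp hUx).aestronglyMeasurable
      ((hG.comp hUx).inner (A.continuous.measurable.comp hUx)).aestronglyMeasurable h1 h2 hxZ
    · simpa only [hUn, mem_ofPred_eq] using h3
    · rw [inner_gradient]
      exact (((hφ (ns k)).1.differentiable (by simp)) (U t x)).hasFDerivAt.comp_hasDerivAt t
        (hUd x t)
    · have h4 := continuous_gradient (hφ (ns k)).1
      have h5 : Continuous fun t => U t x := hUc.clm_apply continuous_const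
      exact (h4.comp h5).inner (A.continuous.comp h5)
  have hPm : MeasurableSet {y | inner ℝ (G₀ y) (A y) = 0 ∨ (‖y‖, u₀ y) ∉ Z} :=
    (measurableSet_eq_fun (hG.inner A.continuous.measurable) measurable_const).union
      ((measurable_norm.prodMk hu) hZm).compl
  rw [Measure.ae_ae_comm (p := fun x t => inner ℝ (G₀ (U t x)) (A (U t x)) = 0 ∨
    (‖U t x‖, u₀ (U t x)) ∉ Z) (hUj.measurable hPm)] at horbit
  have : NeBot (ae (volume.restrict (Ioc (0 : ℝ) 1))) := ae_neBot.2 (by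
    simp [Measure.restrict_eq_zero])
  -- a single time `t` suffices, because `exp(tA)` preserves the measure
  obtain ⟨t, ht⟩ := horbit.exists
  rw [← (hUp t).map_eq]
  exact (ae_map_iff (hUp t).measurable.aemeasurable hPm).2 ht

/-- The generator of the rotations in the plane of the coordinates `i` and `j`. -/
noncomputable def rotationGenerator (i j : Fin N) :
    EuclideanSpace ℝ (Fin N) →L[ℝ] EuclideanSpace ℝ (Fin N) :=
  (EuclideanSpace.proj i).smulRight (EuclideanSpace.single j (1 : ℝ)) -
    (EuclideanSpace.proj j).smulRight (EuclideanSpace.single i (1 : ℝ))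

lemma inner_rotationGenerator (i j : Fin N) (y x : EuclideanSpace ℝ (Fin N)) :
    inner ℝ y (rotationGenerator i j x) = x i * y j - x j * y i := by
  simp [rotationGenerator, inner_sub_right, real_inner_smul_right,
    EuclideanSpace.inner_single_right]

lemma rotationGenerator_mem_skewAdjoint (i j : Fin N) : rotationGenerator i j ∈
    skewAdjoint (EuclideanSpace ℝ (Fin N) →L[ℝ] EuclideanSpace ℝ (Fin N)) := by
  rw [skewAdjoint.mem_iff, ContinuousLinearMap.star_eq_adjoint]
  refine ((ContinuousLinearMap.eq_adjoint_iff _ _).2 fun x y => ?_).symm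
  rw [neg_apply, inner_neg_left, real_inner_comm, inner_rotationGenerator,
    inner_rotationGenerator]
  ring

/-- A vector `y` orthogonal to all the tangential directions at `x` is parallel to `x`, so that
equality holds in the Cauchy-Schwarz inequality. -/
lemma abs_inner_eq_norm_mul_norm_of_rotationGenerator {y x : EuclideanSpace ℝ (Fin N)}
    (h : ∀ i j, inner ℝ y (rotationGenerator i j x) = 0) : |inner ℝ y x| = ‖y‖ * ‖x‖ := by
  have h1 : (inner ℝ y x : ℝ) • x = ‖x‖ ^ 2 • y := by
    ext j
    rw [EuclideanSpace.real_norm_sq_eq]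
    simp only [PiLp.smul_apply, smul_eq_mul, PiLp.inner_apply, RCLike.inner_apply, conj_trivial,
      Finset.sum_mul]
    refine Finset.sum_congr rfl fun i _ => ?_
    have := h i j
    rw [inner_rotationGenerator] at this
    linear_combination (-x i) * this
  rcases eq_or_ne x 0 with rfl | hx
  · simp
  · have h2 := congrArg norm h1
    rw [norm_smul, norm_smul, norm_pow, norm_norm, Real.norm_eq_abs] at h2
    have hx0 : ‖x‖ ≠ 0 := norm_ne_zero_iff.2 hx
    apply mul_right_cancel₀ hx0
    rw [h2]
    ring

/-! ### Comparison of the two problems -/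

/-- The integrand does not increase, almost everywhere, when the gradient is replaced by its radial
component. The monotonicity of `f(r,t,·)` may fail for a null set of pairs `(r,t)`, which can
contain `(|x|, u x)` for a set of `x` of positive measure; at almost every such `x` the gradient is
radial. -/
lemma ae_integrand_radial_le (hN : 1 ≤ N) {R : ℝ} {f : ℝ → ℝ → ℝ → EReal}
    (hmono : ∀ᵐ p : ℝ × ℝ ∂(volume.restrict (Icc 0 R ×ˢ (univ : Set ℝ))),
      MonotoneOn (f p.1 p.2) (Ici 0))
    {u₀ : EuclideanSpace ℝ (Fin N) → ℝ}
    {G₀ : EuclideanSpace ℝ (Fin N) → EuclideanSpace ℝ (Fin N)} (hu : Measurable u₀)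
    (hG : Measurable G₀) {φ : ℕ → EuclideanSpace ℝ (Fin N) → ℝ}
    (hφ : ∀ n, IsTestFunction (Metric.ball 0 R) (φ n))
    (hlim : Tendsto (fun n => ∫⁻ x in Metric.ball 0 R,
      (‖u₀ x - φ n x‖ₑ + ‖G₀ x - gradient (φ n) x‖ₑ)) atTop (𝓝 0)) :
    ∀ᵐ x ∂(volume.restrict (Metric.ball 0 R)),
      f ‖x‖ (u₀ x) |inner ℝ (G₀ x) (‖x‖⁻¹ • x)| ≤ f ‖x‖ (u₀ x) ‖G₀ x‖ := by
  rw [Measure.volume_eq_prod, ← Measure.prod_restrict, Measure.restrict_univ] at hmono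
  set Z : Set (ℝ × ℝ) := toMeasurable ((volume.restrict (Icc 0 R)).prod volume)
    {p | ¬ MonotoneOn (f p.1 p.2) (Ici 0)} with hZdef
  have hZ0 : ((volume.restrict (Icc 0 R)).prod volume) Z = 0 := by
    rw [measure_toMeasurable]
    exact ae_iff.1 hmono
  have hZ : ∀ᵐ r ∂(volume.restrict (Ioo 0 R)), volume {t | (r, t) ∈ Z} = 0 := by
    refine ae_restrict_of_ae_restrict_of_subset Ioo_subset_Icc_self ?_
    filter_upwards [Measure.ae_ae_of_ae_prod (measure_eq_zero_iff_ae_notMem.1 hZ0)] with r hr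
    simpa [ae_iff] using hr
  have htan : ∀ᵐ x ∂(volume.restrict (Metric.ball (0 : EuclideanSpace ℝ (Fin N)) R)), ∀ i j,
      inner ℝ (G₀ x) (rotationGenerator i j x) = 0 ∨ (‖x‖, u₀ x) ∉ Z :=
    ae_all_iff.2 fun i => ae_all_iff.2 fun j =>
      ae_inner_skewAdjoint_eq_zero_or_notMem hN hu hG hφ hlim
        (rotationGenerator_mem_skewAdjoint i j) (measurableSet_toMeasurable _ _) hZ
  have hpos : ∀ᵐ x ∂(volume.restrict (Metric.ball (0 : EuclideanSpace ℝ (Fin N)) R)),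
      ‖x‖ ∈ Ioo 0 R :=
    (quasiMeasurePreserving_norm_ball hN R).ae (ae_restrict_mem measurableSet_Ioo)
  filter_upwards [htan, hpos] with x hx hx0
  by_cases hxZ : (‖x‖, u₀ x) ∈ Z
  · have h1 := abs_inner_eq_norm_mul_norm_of_rotationGenerator
      fun i j => (hx i j).resolve_right (not_not.2 hxZ)
    rw [real_inner_smul_right, abs_mul, h1, abs_inv, abs_norm, mul_comm,
      mul_inv_cancel_right₀ hx0.1.ne']
  · have h1 : MonotoneOn (f ‖x‖ (u₀ x)) (Ici 0) := by
      by_contra h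
      exact hxZ (subset_toMeasurable _ _ h)
    refine h1 (mem_Ici.2 (abs_nonneg _)) (mem_Ici.2 (norm_nonneg _)) ?_
    have h2 := abs_real_inner_le_norm (G₀ x) (‖x‖⁻¹ • x)
    rwa [norm_smul, norm_inv, norm_norm, inv_mul_cancel₀ hx0.1.ne', mul_one] at h2

/-- Every bound `M > -∞` for the energy of a function of `W^{1,1}_0` is, up to the area of the
sphere, a bound for the radial energy of its restriction to some ray. -/
lemma MemW11Zero.exists_memWrad_le (hN : 1 ≤ N) {R : ℝ} (hR : 0 < R) {f : ℝ → ℝ → ℝ → EReal}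
    (hf : IsNormalIntegrand R f)
    (hmono : ∀ᵐ p : ℝ × ℝ ∂(volume.restrict (Icc 0 R ×ˢ (univ : Set ℝ))),
      MonotoneOn (f p.1 p.2) (Ici 0))
    {u : EuclideanSpace ℝ (Fin N) → ℝ} (hu : MemW11Zero (Metric.ball 0 R) u)
    {M : EReal} (hM : M ≠ ⊥) (huM : energy N R f u ≤ M) :
    ∃ v, MemWrad N R v ∧ (sphereArea N : EReal) * radialEnergy N R f v ≤ M := by
  have : Nonempty (Fin N) := ⟨⟨0, hN⟩⟩
  obtain ⟨u₀, G₀, φ, hu₀, hG₀, hu_eq, hG_eq, hφ, hlim⟩ := hu.exists_measurable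
  have hpol := measurePreserving_polar hN R
  set σ := (volume : Measure (EuclideanSpace ℝ (Fin N))).toSphere
  have hrad : ∀ᵐ r ∂(radialMeasure N R), r ∈ Ioo 0 R :=
    (radialMeasure_absolutelyContinuous N R).ae_le (ae_restrict_mem measurableSet_Ioo)
  set K : Metric.sphere (0 : EuclideanSpace ℝ (Fin N)) 1 × ℝ → EReal :=
    fun p => f p.2 (u₀ (p.2 • p.1.1)) ‖G₀ (p.2 • p.1.1)‖
  have hK : AEMeasurable K (σ.prod (radialMeasure N R)) := by
    refine hf.aemeasurable_comp ?_ (hu₀.comp hpol.measurable).aemeasurable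
      (hG₀.comp hpol.measurable).norm.aemeasurable (fun _ => norm_nonneg _)
    exact Measure.quasiMeasurePreserving_snd.mono_right (radialMeasure_absolutelyContinuous N R)
  have hKM : extIntegral (σ.prod (radialMeasure N R)) K ≤ M := by
    refine le_of_eq_of_le ?_ huM
    have hH : AEMeasurable (fun x => f ‖x‖ (u₀ x) ‖G₀ x‖)
        (volume.restrict (Metric.ball (0 : EuclideanSpace ℝ (Fin N)) R)) :=
      hf.aemeasurable_comp (quasiMeasurePreserving_norm_ball hN R) hu₀.aemeasurable
        hG₀.norm.aemeasurable (fun _ => norm_nonneg _)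
    calc extIntegral (σ.prod (radialMeasure N R)) K
        = extIntegral (σ.prod (radialMeasure N R))
            (fun p => f ‖p.2 • p.1.1‖ (u₀ (p.2 • p.1.1)) ‖G₀ (p.2 • p.1.1)‖) := by
          refine extIntegral_congr ?_
          filter_upwards [Measure.quasiMeasurePreserving_snd.ae hrad] with p hp
          have : ‖p.2 • p.1.1‖ = p.2 := by simp [norm_smul, abs_of_pos hp.1]
          rw [this]
      _ = extIntegral (volume.restrict (Metric.ball 0 R)) (fun x => f ‖x‖ (u₀ x) ‖G₀ x‖) := by
          rw [← hpol.map_eq] at hH ⊢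
          rw [extIntegral_map hpol.measurable.aemeasurable hH]
      _ = energy N R f u := by
          refine extIntegral_congr ?_
          filter_upwards [hu_eq, hG_eq] with x h1 h2
          rw [h1, h2]
  have hray : ∀ᵐ θ ∂σ, ∃ v, MemWrad N R v ∧
      ∀ᵐ r ∂(radialMeasure N R), f r (v r) |deriv v r| ≤ K (θ, r) := by
    filter_upwards [ae_exists_memWrad_ray hN hR hu₀ hG₀ hφ hlim,
      ae_ae_polar hN (ae_integrand_radial_le hN hmono hu₀ hG₀ hφ hlim)] with θ ⟨v, hv, hvr⟩ hθ
    refine ⟨v, hv, ?_⟩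
    filter_upwards [(radialMeasure_absolutelyContinuous N R).ae_le hvr, hθ, hrad]
      with r h1 h2 hr
    have hn : ‖r • θ.1‖ = r := by simp [norm_smul, abs_of_pos hr.1]
    rw [hn, inv_smul_smul₀ hr.1.ne'] at h2
    rw [h1.1, h1.2]
    exact h2
  obtain ⟨θ, ⟨v, hv, hvK⟩, hle⟩ :=
    exists_slice_extIntegral_le (Measure.toSphere_ne_zero _) hK hray hM hKM
  refine ⟨v, hv, le_trans ?_ hle⟩
  rw [radialEnergy_eq]
  exact mul_le_mul_of_nonneg_left (extIntegral_mono hvK) (EReal.coe_ennreal_nonneg _)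

lemma sphereArea_mul_le_mul_iff (hN : 1 ≤ N) {a b : EReal} :
    (sphereArea N : EReal) * a ≤ (sphereArea N : EReal) * b ↔ a ≤ b := by
  have h0 : (0 : EReal) < sphereArea N :=
    EReal.coe_ennreal_pos_iff_ne_zero.2 (sphereArea_ne_zero hN)
  have ht : (sphereArea N : EReal) ≠ ⊤ := by simpa using sphereArea_ne_top (N := N)
  refine ⟨fun h => ?_, fun h => mul_le_mul_of_nonneg_left h h0.le⟩
  rw [mul_comm, ← EReal.le_div_iff_mul_le h0 ht, ← EReal.mul_div,
    EReal.mul_div_cancel (EReal.coe_ennreal_ne_bot _) ht h0.ne'] at h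
  exact h

lemma sphereArea_mul_eq_bot_iff (hN : 1 ≤ N) {a : EReal} :
    (sphereArea N : EReal) * a = ⊥ ↔ a = ⊥ := by
  have h0 : (0 : EReal) < sphereArea N :=
    EReal.coe_ennreal_pos_iff_ne_zero.2 (sphereArea_ne_zero hN)
  rw [← le_bot_iff, ← le_bot_iff, ← sphereArea_mul_le_mul_iff hN (a := a),
    EReal.mul_bot_of_pos h0]

end RadialVar

theorem mainTheorem2 (N : ℕ) (hN : 1 ≤ N) (R : ℝ) (hR : 0 < R) (f : ℝ → ℝ → ℝ → EReal)
    (hf : RadialVar.IsNormalIntegrand R f)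
    (hmono : ∀ᵐ p : ℝ × ℝ ∂(volume.restrict (Icc 0 R ×ˢ (univ : Set ℝ))),
      MonotoneOn (f p.1 p.2) (Ici 0)) :
    (∃ u : EuclideanSpace ℝ (Fin N) → ℝ,
      RadialVar.IsSolution (RadialVar.MemW11Zero (Metric.ball 0 R))
        (RadialVar.energy N R f) u) ↔
    (∃ u : ℝ → ℝ,
      RadialVar.IsSolution (RadialVar.MemWrad N R) (RadialVar.radialEnergy N R f) u) := by
  constructor
  · rintro ⟨u, hu, hbot, hmin⟩
    obtain ⟨v, hv, hvu⟩ := hu.exists_memWrad_le hN hR hf hmono hbot le_rfl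
    have hlow : ∀ w, RadialVar.MemWrad N R w → RadialVar.energy N R f u ≤
        (RadialVar.sphereArea N : EReal) * RadialVar.radialEnergy N R f w := fun w hw => by
      rw [← hw.energy_eq hN hR hf]
      exact hmin _ (hw.memW11Zero hN hR).1
    refine ⟨v, hv, fun h => hbot ?_, fun w hw => ?_⟩
    · have := hlow v hv
      rwa [(RadialVar.sphereArea_mul_eq_bot_iff hN).2 h, le_bot_iff] at this
    · exact (RadialVar.sphereArea_mul_le_mul_iff hN).1 (hvu.trans (hlow w hw))
  · rintro ⟨w, hw, hbot, hmin⟩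
    refine ⟨fun x => w ‖x‖, (hw.memW11Zero hN hR).1, ?_, fun u hu => ?_⟩
    · rwa [hw.energy_eq hN hR hf, ne_eq, RadialVar.sphereArea_mul_eq_bot_iff hN]
    · rw [hw.energy_eq hN hR hf]
      by_contra! hlt
      -- a bound strictly above the energy of `u` is never `⊥`
      obtain ⟨M, huM, hMw⟩ := exists_between hlt
      obtain ⟨v, hv, hvM⟩ := hu.exists_memWrad_le hN hR hf hmono (bot_le.trans_lt huM).ne' huM.le
      have := (RadialVar.sphereArea_mul_le_mul_iff hN).2 (hmin v hv)
      exact absurd (this.trans hvM) hMw.not_ge
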